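/- Let $G$ be (isomorphic to) a subgroup of one of the groups $$\mathbb{Z}_2^5,\quad \mathbb{Z}_p^3,\quad \mathbb{Z}_{p^n}\times\mathbb{Z}_p,\quad \mathbb{Z}_{2^3}\times\mathbb{Z}_2^2,\quad \mathbb{Z}_{2^2}\times\mathbb{Z}_2^3,$$ where $p$ is a prime and $n$ is a positive integer, and let $m$ be a square-free positive integer with $\gcd(|G|,m)=1$. Then every tile of $G\times\mathbb{Z}_m$ is a spectral set. Here a subset $\Omega$ of a finite abelian group $H$ is a tile if there is a set $T\subset H$ such that every element of $H$ can be written uniquely as $\omega+t$ with $\omega\in\Omega$, $t\in T$. A nonempty subset $\Omega$ of $H$ is a spectral set if there is a set $\Lambda$ of characters of $H$ whose restrictions to $\Omega$ form an orthogonal basis of $L^2(\Omega)$ (with respect to counting measure). -/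

import Mathlib

/-- `(Ω, T)` is a tiling pair of `G`: every element of `G` is `ω + t` with `ω ∈ Ω`, `t ∈ T`
in exactly one way. -/
def IsTilingPair {G : Type*} [AddCommGroup G] [Finite G] (Ω T : Finset G) : Prop :=
  ∀ g : G, ∃! x : G × G, x.1 ∈ Ω ∧ x.2 ∈ T ∧ x.1 + x.2 = g

/-- `Ω` is a tile of `G` (by translation). -/
def IsTile {G : Type*} [AddCommGroup G] [Finite G] (Ω : Finset G) : Prop :=
  ∃ T : Finset G, IsTilingPair Ω T

/-- The restriction of the character `χ` to `Ω`, as a vector of `L²(Ω)` (for counting measure). -/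
noncomputable def charVec {G : Type*} [AddCommGroup G] [Finite G] (Ω : Finset G)
    (χ : AddChar G ℂ) : EuclideanSpace ℂ Ω :=
  WithLp.toLp 2 fun x => χ (x : G)

/-- `Λ` is a spectrum of `Ω`: the characters in `Λ`, restricted to `Ω`, are an orthogonal basis of
`L²(Ω)`. For `Ω` nonempty their restrictions never vanish, so that orthogonality makes them
distinct and linearly independent. -/
def IsSpectrum {G : Type*} [AddCommGroup G] [Finite G] (Ω : Finset G)
    (Λ : Set (AddChar G ℂ)) : Prop :=
  (∀ χ ∈ Λ, ∀ ψ ∈ Λ, χ ≠ ψ → inner ℂ (charVec Ω χ) (charVec Ω ψ) = 0) ∧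
    Submodule.span ℂ (charVec Ω '' Λ) = ⊤

/-- `Ω` is a spectral set: it is nonempty (has positive Haar measure) and has a spectrum. -/
def IsSpectralSet {G : Type*} [AddCommGroup G] [Finite G] (Ω : Finset G) : Prop :=
  Ω.Nonempty ∧ ∃ Λ : Set (AddChar G ℂ), IsSpectrum Ω Λ

/-- `G` is (isomorphic to) a subgroup of `A`. -/
def IsSubgroupOf (G A : Type*) [AddCommGroup G] [AddCommGroup A] : Prop :=
  ∃ f : G →+ A, Function.Injective f

/-! Write T^ for the Fourier transform of the indicator of T. If B + T tiles, then B^ · T^ vanishes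
at every nontrivial character. So it is enough to find |B| characters whose differences avoid the
zeros of T^. Such a set depends on T alone and is a spectrum of every complement of T at once
(`hasUniversalSpectra_of_forall`). This uniform property, `HasUniversalSpectra`, is what gets
proved, because it is stable where "tiles are spectral" is not evidently so.

It passes to subgroups (`HasUniversalSpectra.of_injective`) and to products with `ZMod q`, for a
prime q not dividing the order (`HasUniversalSpectra.prod_zmod`). In the second case one member of
the tiling has size prime to q. By the replacement theorem `IsTilingPair.image_nsmul` it may be
replaced by its projection to the first factor. The layers of B then share a complement, hence a
spectrum. Square-free m follows by induction.

This leaves the five groups. For order 32 the sizes of T are treated in turn. If T has 2 or 4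
points, characters are chosen with prescribed values in a half circle. If B has 2 or 4 points, the
spectrum is written down from nonzeros of T^, found by a convolution identity. For `ZMod p` cubed,
|T| or |B| is at most p. Galois conjugation of zeros then shows that an annihilator or a cyclic
group of characters works. For `ZMod (p ^ n) × ZMod p`, the spectrum is a set of digit expansions.
Its digits sit at the levels k where T^ does not vanish on the first axis, with possibly one more
generator. A count of exponents shows that these levels account for |B|, or that the complementary
levels account for |T|. In the second case T is so rigid that zeros off the axis propagate from
level to level (`exists_goodFor_of_full`). -/

open Finset

/-- The Fourier transform at `χ` of the indicator function of `T`. -/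
noncomputable def charSum {G : Type*} [AddCommGroup G] (T : Finset G) (χ : AddChar G ℂ) : ℂ :=
  ∑ t ∈ T, χ t

/-- For every `T` the tiling complements of `T` have a common spectrum. -/
def HasUniversalSpectra (G : Type*) [AddCommGroup G] [Finite G] : Prop :=
  ∀ T : Finset G, ∃ Λ : Finset (AddChar G ℂ), ∀ B : Finset G, IsTilingPair B T →
    Λ.card = B.card ∧ ∀ χ ∈ Λ, ∀ ψ ∈ Λ, χ ≠ ψ → charSum B (χ - ψ) = 0

/-! ### Tilings, zeros of the transform, and spectra -/

section Basic

variable {G : Type*} [AddCommGroup G]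

@[simp] lemma charSum_zero (T : Finset G) : charSum T 0 = T.card := by simp [charSum]

lemma charSum_neg [Finite G] (T : Finset G) (χ : AddChar G ℂ) :
    charSum T (-χ) = (starRingEnd ℂ) (charSum T χ) := by
  simp [charSum, AddChar.map_neg_eq_conj]

lemma charSum_neg_eq_zero [Finite G] {T : Finset G} {χ : AddChar G ℂ} :
    charSum T (-χ) = 0 ↔ charSum T χ = 0 := by
  rw [charSum_neg, map_eq_zero]

lemma charSum_sub_comm [Finite G] {T : Finset G} {χ ψ : AddChar G ℂ} :
    charSum T (χ - ψ) = 0 ↔ charSum T (ψ - χ) = 0 := by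
  rw [← neg_sub, charSum_neg_eq_zero]

lemma IsTilingPair.symm [Finite G] {B T : Finset G} (h : IsTilingPair B T) : IsTilingPair T B := by
  intro g
  obtain ⟨⟨b, t⟩, ⟨hb, ht, e⟩, hu⟩ := h g
  refine ⟨(t, b), ⟨ht, hb, by simpa [add_comm] using e⟩, ?_⟩
  rintro ⟨t', b'⟩ ⟨ht', hb', e'⟩
  have := hu (b', t') ⟨hb', ht', by simpa [add_comm] using e'⟩
  simp only [Prod.mk.injEq] at this ⊢
  exact this.symm

/-- The bijection `B × T → G` of a tiling pair, as an identity of sums. -/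
lemma IsTilingPair.sum_eq [Fintype G] {M : Type*} [AddCommMonoid M] {B T : Finset G}
    (h : IsTilingPair B T) (f : G → M) : ∑ b ∈ B, ∑ t ∈ T, f (b + t) = ∑ g, f g := by
  rw [← Finset.sum_product']
  refine Finset.sum_bij (fun x _ => x.1 + x.2) (fun _ _ => mem_univ _) ?_ ?_ (fun _ _ => rfl)
  · intro x hx y hy e
    rw [mem_product] at hx hy
    exact (h (x.1 + x.2)).unique ⟨hx.1, hx.2, rfl⟩ ⟨hy.1, hy.2, e.symm⟩
  · intro g _
    obtain ⟨x, ⟨h1, h2, h3⟩, _⟩ := h g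
    exact ⟨x, mem_product.2 ⟨h1, h2⟩, h3⟩

lemma IsTilingPair.card_mul [Finite G] {B T : Finset G} (h : IsTilingPair B T) :
    B.card * T.card = Nat.card G := by
  cases nonempty_fintype G
  simpa using h.sum_eq (fun _ => (1 : ℕ))

lemma IsTilingPair.nonempty [Finite G] {B T : Finset G} (h : IsTilingPair B T) : B.Nonempty := by
  obtain ⟨x, ⟨h1, _⟩, _⟩ := h 0
  exact ⟨_, h1⟩

/-- A covering by `B + T` with the right number of pairs is a tiling. -/
lemma isTilingPair_of_surj [Finite G] {B T : Finset G} (hc : B.card * T.card ≤ Nat.card G)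
    (h : ∀ g : G, ∃ b ∈ B, ∃ t ∈ T, b + t = g) : IsTilingPair B T := by
  cases nonempty_fintype G
  have hs : Set.SurjOn (fun x : G × G => x.1 + x.2) (B ×ˢ T : Finset (G × G))
      (univ : Finset G) := by
    intro g _
    obtain ⟨b, hb, t, ht, e⟩ := h g
    exact ⟨(b, t), by simp [hb, ht], e⟩
  have hi := Finset.injOn_of_surjOn_of_card_le (s := B ×ˢ T) (t := (univ : Finset G))
    (fun x : G × G => x.1 + x.2) (fun _ _ => by simp) hs
    (by rw [card_product, card_univ, ← Nat.card_eq_fintype_card]; exact hc)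
  intro g
  obtain ⟨b, hb, t, ht, e⟩ := h g
  refine ⟨(b, t), ⟨hb, ht, e⟩, ?_⟩
  rintro y ⟨h1, h2, h3⟩
  exact hi (by simp [h1, h2]) (by simp [hb, ht]) (by simp [h3, e])

lemma IsTilingPair.charSum_mul [Finite G] {B T : Finset G} (h : IsTilingPair B T)
    {χ : AddChar G ℂ} (hχ : χ ≠ 0) : charSum B χ * charSum T χ = 0 := by
  cases nonempty_fintype G
  have := h.sum_eq χ
  rw [AddChar.sum_eq_zero_iff_ne_zero.2 hχ] at this
  rw [charSum, charSum, Finset.sum_mul_sum, ← this]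
  simp [AddChar.map_add_eq_mul]

/-- A set of characters whose differences avoid the zeros of the transform of `T` is a spectrum of
all complements of `T`. -/
lemma hasUniversalSpectra_of_forall [Finite G]
    (h : ∀ B T : Finset G, IsTilingPair B T → ∃ Λ : Finset (AddChar G ℂ), Λ.card = B.card ∧
      ∀ χ ∈ Λ, ∀ ψ ∈ Λ, χ ≠ ψ → charSum T (χ - ψ) ≠ 0) : HasUniversalSpectra G := by
  intro T
  by_cases hT : ∃ B, IsTilingPair B T
  · obtain ⟨B₀, hB₀⟩ := hT
    obtain ⟨Λ, hc, hΛ⟩ := h B₀ T hB₀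
    refine ⟨Λ, fun B hB => ⟨?_, fun χ hχ ψ hψ hne => ?_⟩⟩
    · rw [hc]
      exact Nat.eq_of_mul_eq_mul_right (card_pos.2 hB.symm.nonempty)
        (hB₀.card_mul.trans hB.card_mul.symm)
    · exact (mul_eq_zero.1 (hB.charSum_mul (sub_ne_zero.2 hne))).resolve_right (hΛ χ hχ ψ hψ hne)
  · exact ⟨∅, fun B hB => (hT ⟨B, hB⟩).elim⟩

lemma IsSpectrum.of_charSum [Finite G] {Ω : Finset G} {Λ : Finset (AddChar G ℂ)}
    (hΩ : Ω.Nonempty) (hc : Λ.card = Ω.card)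
    (h : ∀ χ ∈ Λ, ∀ ψ ∈ Λ, χ ≠ ψ → charSum Ω (χ - ψ) = 0) :
    IsSpectrum Ω (Λ : Set (AddChar G ℂ)) := by
  have hin : ∀ χ ψ : AddChar G ℂ, inner ℂ (charVec Ω χ) (charVec Ω ψ) = charSum Ω (ψ - χ) := by
    intro χ ψ
    simp only [charVec, PiLp.inner_apply, charSum, RCLike.inner_apply]
    rw [← Finset.sum_coe_sort Ω]
    refine Finset.sum_congr rfl fun x _ => ?_
    rw [AddChar.sub_apply, AddChar.map_neg_eq_conj]
  have horth : ∀ χ ∈ Λ, ∀ ψ ∈ Λ, χ ≠ ψ → inner ℂ (charVec Ω χ) (charVec Ω ψ) = 0 :=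
    fun χ hχ ψ hψ hne => by rw [hin]; exact h ψ hψ χ hχ hne.symm
  refine ⟨fun χ hχ ψ hψ => horth χ hχ ψ hψ, ?_⟩
  have hli : LinearIndependent ℂ (fun χ : Λ => charVec Ω (χ : AddChar G ℂ)) := by
    refine linearIndependent_of_ne_zero_of_inner_eq_zero ?_ ?_
    · intro χ h0
      have := hin χ χ
      rw [h0, sub_self, charSum_zero, inner_zero_left] at this
      exact hΩ.card_pos.ne' (by exact_mod_cast this.symm)
    · intro χ ψ hne
      exact horth _ χ.2 _ ψ.2 (fun e => hne (Subtype.ext e))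
  have hspan := hli.span_eq_top_of_card_eq_finrank' (by simp [hc])
  rw [← hspan]
  congr 1
  ext v
  simp

lemma HasUniversalSpectra.isSpectralSet [Finite G] (hG : HasUniversalSpectra G) {Ω : Finset G}
    (h : IsTile Ω) : IsSpectralSet Ω := by
  obtain ⟨T, hT⟩ := h
  obtain ⟨Λ, hΛ⟩ := hG T
  exact ⟨hT.nonempty, Λ, IsSpectrum.of_charSum hT.nonempty (hΛ Ω hT).1 (hΛ Ω hT).2⟩

end Basic

/-! ### Replacing a tiling complement by a multiple of itself -/

section Sands

variable {G : Type*} [AddCommGroup G]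

/-- In the group algebra over `ZMod p` the tiling reads B · T = N, where N is the sum of all
elements. Frobenius turns T ^ p into the sum over p • T, and B · T ^ p = N · T ^ (p - 1) = |T| ^ (p
- 1) N = N by Fermat. All coefficients of N are 1, so B + p • T misses nothing, and counting makes
the covering a tiling. -/
lemma IsTilingPair.image_nsmul_prime [Finite G] [DecidableEq G] {B T : Finset G}
    (h : IsTilingPair B T) {p : ℕ} (hp : p.Prime) (hpT : ¬ p ∣ T.card) :
    IsTilingPair B (T.image (p • ·)) := by
  cases nonempty_fintype G
  have : Fact p.Prime := ⟨hp⟩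
  let δ : G → AddMonoidAlgebra (ZMod p) G := fun g => AddMonoidAlgebra.single g 1
  have hδ : ∀ a b, δ a * δ b = δ (a + b) := fun a b => by
    simp [δ, AddMonoidAlgebra.single_mul_single]
  have hδp : ∀ (a : G) (k : ℕ), δ a ^ k = δ (k • a) := fun a k => by
    simp [δ, AddMonoidAlgebra.single_pow]
  have : CharP (AddMonoidAlgebra (ZMod p) G) p :=
    charP_of_injective_algebraMap (FaithfulSMul.algebraMap_injective (ZMod p) _) p
  set N : AddMonoidAlgebra (ZMod p) G := ∑ g, δ g with hN
  have hBT : (∑ b ∈ B, δ b) * ∑ t ∈ T, δ t = N := by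
    rw [Finset.sum_mul_sum, hN, ← h.sum_eq δ]
    simp [hδ]
  have hNδ : ∀ t, N * δ t = N := fun t => by
    rw [hN, Finset.sum_mul]
    simp only [hδ]
    exact Fintype.sum_equiv (Equiv.addRight t) _ _ (fun _ => rfl)
  have hNT : N * ∑ t ∈ T, δ t = (T.card : ZMod p) • N := by
    rw [Finset.mul_sum]
    simp [hNδ, Nat.cast_smul_eq_nsmul]
  have hNk : ∀ k, N * (∑ t ∈ T, δ t) ^ k = (T.card : ZMod p) ^ k • N := by
    intro k
    induction k with
    | zero => simp
    | succ k ih => rw [pow_succ, ← mul_assoc, ih, smul_mul_assoc, hNT, smul_smul, pow_succ]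
  have hfrob : (∑ t ∈ T, δ t) ^ p = ∑ t ∈ T, δ (p • t) := by
    rw [← frobenius_def, map_sum]
    simp [frobenius_def, hδp]
  have hT0 : (T.card : ZMod p) ≠ 0 := by rwa [Ne, ZMod.natCast_eq_zero_iff]
  have key : (∑ b ∈ B, δ b) * ∑ t ∈ T, δ (p • t) = N := by
    rw [← hfrob, ← mul_pow_sub_one hp.ne_zero, ← mul_assoc, hBT, hNk,
      ZMod.pow_card_sub_one_eq_one hT0, one_smul]
  refine isTilingPair_of_surj ?_ fun g => ?_
  · rw [← h.card_mul]
    exact Nat.mul_le_mul_left _ card_image_le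
  · by_contra hg
    push Not at hg
    rw [Finset.sum_mul_sum] at key
    simp only [hδ] at key
    have h1 := congrArg (fun x : AddMonoidAlgebra (ZMod p) G => x.coeff g) key
    simp only [hN, δ, AddMonoidAlgebra.coeff_sum, AddMonoidAlgebra.coeff_single,
      Finsupp.finsetSum_apply, Finsupp.single_apply] at h1
    rw [Finset.sum_eq_zero] at h1
    · simp at h1
    · intro b hb
      refine Finset.sum_eq_zero fun t ht => if_neg ?_
      exact hg b hb _ (mem_image_of_mem _ ht)

lemma IsTilingPair.image_nsmul [Finite G] [DecidableEq G] {B T : Finset G}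
    (h : IsTilingPair B T) {k : ℕ} (hk : k ≠ 0) (hkT : k.Coprime T.card) :
    IsTilingPair B (T.image (k • ·)) := by
  induction k using Nat.recOnMul generalizing T with
  | zero => exact absurd rfl hk
  | one => simpa using h
  | prime p hp => exact h.image_nsmul_prime hp ((hp.coprime_iff_not_dvd).1 hkT)
  | mul a b iha ihb =>
    have ha : a ≠ 0 := by rintro rfl; simp at hk
    have hb : b ≠ 0 := by rintro rfl; simp at hk
    have h1 := iha h ha (Nat.Coprime.coprime_mul_right hkT)
    have hcard : (T.image (a • ·)).card = T.card :=
      Nat.eq_of_mul_eq_mul_left (card_pos.2 h.nonempty) (h1.card_mul.trans h.card_mul.symm)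
    have h2 := ihb h1 hb (by rw [hcard]; exact Nat.Coprime.coprime_mul_left hkT)
    rw [image_image] at h2
    convert h2 using 2
    ext x
    simp [mul_comm a b, mul_smul]

end Sands

/-! ### Passage to subgroups -/

section Transfer

lemma AddChar.sub_compAddMonoidHom {G A : Type*} [AddCommGroup G] [AddCommGroup A]
    (χ ψ : AddChar A ℂ) (f : G →+ A) :
    (χ - ψ).compAddMonoidHom f = χ.compAddMonoidHom f - ψ.compAddMonoidHom f := by
  ext g
  simp [AddChar.sub_apply']

/-- Enlarging T by representatives of the cosets of the subgroup gives a complement, in the big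
group, of the image of every complement of T. A spectrum there restricts to the subgroup;
orthogonality keeps distinct characters distinct after restriction. -/
lemma HasUniversalSpectra.of_injective {G A : Type*} [AddCommGroup G] [Finite G] [AddCommGroup A]
    [Finite A] (hA : HasUniversalSpectra A) (f : G →+ A) (hf : Function.Injective f) :
    HasUniversalSpectra G := by
  classical
  intro T
  cases nonempty_fintype A
  let out : A ⧸ f.range → A := Quotient.out
  have hout : ∀ q, (QuotientAddGroup.mk (out q) : A ⧸ f.range) = q := fun q => Quotient.out_eq q
  let T' : Finset A := univ.filter fun a => ∃ t ∈ T, ∃ q, f t + out q = a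
  obtain ⟨Λ, hΛ⟩ := hA T'
  refine ⟨Λ.image fun χ => χ.compAddMonoidHom f, fun B hB => ?_⟩
  have hB' : IsTilingPair (B.image f) T' := by
    intro a
    have hmem : -out (QuotientAddGroup.mk a) + a ∈ f.range := by
      rw [← QuotientAddGroup.eq, hout]
    obtain ⟨g, hg⟩ := hmem
    obtain ⟨⟨b, t⟩, ⟨hb, ht, e⟩, hu⟩ := hB g
    simp only at e hb ht
    refine ⟨(f b, f t + out (QuotientAddGroup.mk a)), ⟨mem_image_of_mem _ hb, ?_, ?_⟩, ?_⟩
    · exact mem_filter.2 ⟨mem_univ _, t, ht, _, rfl⟩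
    · simp only
      rw [← add_assoc, ← map_add, e, hg]
      abel
    · rintro ⟨x, y⟩ ⟨hx, hy, e'⟩
      simp only at hx hy e'
      obtain ⟨b', hb', rfl⟩ := mem_image.1 hx
      obtain ⟨-, t', ht', q, rfl⟩ := mem_filter.1 hy
      have hq : q = QuotientAddGroup.mk a := by
        rw [← hout q, QuotientAddGroup.eq, ← e']
        exact ⟨b' + t', by rw [map_add]; abel⟩
      subst hq
      have e2 : f (b' + t') = f g := by
        rw [hg, map_add, eq_neg_add_iff_add_eq]
        conv_rhs => rw [← e']
        abel
      have := hu (b', t') ⟨hb', ht', hf e2⟩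
      simp only [Prod.mk.injEq] at this
      rw [this.1, this.2]
  obtain ⟨hc, ho⟩ := hΛ _ hB'
  have hsum : ∀ χ : AddChar A ℂ, charSum (B.image f) χ = charSum B (χ.compAddMonoidHom f) := by
    intro χ
    rw [charSum, charSum, sum_image hf.injOn]
    rfl
  refine ⟨?_, ?_⟩
  · rw [card_image_of_injOn, hc, card_image_of_injective _ hf]
    intro χ hχ ψ hψ e
    by_contra hne
    have h0 := ho χ hχ ψ hψ hne
    have h1 : (χ - ψ).compAddMonoidHom f = 0 := by
      ext g
      have := DFunLike.congr_fun e g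
      simp only [AddChar.compAddMonoidHom_apply] at this
      simp [AddChar.sub_apply', this, (AddChar.val_isUnit ψ (f g)).ne_zero]
    rw [hsum, h1, charSum_zero] at h0
    exact (card_pos.2 hB.nonempty).ne' (by exact_mod_cast h0)
  · intro χ' hχ' ψ' hψ' hne
    obtain ⟨χ, hχ, rfl⟩ := mem_image.1 hχ'
    obtain ⟨ψ, hψ, rfl⟩ := mem_image.1 hψ'
    have hne' : χ ≠ ψ := fun e => hne (by rw [e])
    have := ho χ hχ ψ hψ hne'
    rw [hsum] at this
    rwa [AddChar.sub_compAddMonoidHom] at this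

end Transfer

/-! ### Products with a cyclic group of coprime prime order -/

section Product

variable {H : Type*} [AddCommGroup H] [Finite H]

/-- By the Chinese remainder theorem, projection to `H` is multiplication by an integer, so the
replacement theorem applies to it. -/
lemma exists_nsmul_eq_fst {q : ℕ} [Fact q.Prime] (hq : ¬ q ∣ Nat.card H) :
    ∃ k : ℕ, k ≠ 0 ∧ (∀ x : H × ZMod q, k • x = (x.1, 0)) ∧
      ∀ d, d ∣ Nat.card H * q → ¬ q ∣ d → k.Coprime d := by
  have hqp : q.Prime := Fact.out
  have hco : (Nat.card H).Coprime q := ((Nat.Prime.coprime_iff_not_dvd hqp).2 hq).symm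
  obtain ⟨k₀, h1, h0⟩ := Nat.chineseRemainder hco 1 0
  have hH : 0 < Nat.card H := Nat.card_pos
  -- Adding a full period makes k nonzero, also when `H` is trivial and k₀ may be 0.
  set k := k₀ + Nat.card H * q with hk
  have h1' : k ≡ 1 [MOD Nat.card H] := by
    simpa [hk] using Nat.ModEq.add h1
      ((Nat.modEq_zero_iff_dvd (n := Nat.card H)).2 (dvd_mul_right _ q))
  have h0' : k ≡ 0 [MOD q] := by
    simpa [hk] using Nat.ModEq.add h0
      ((Nat.modEq_zero_iff_dvd (n := q)).2 (dvd_mul_left _ (Nat.card H)))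
  refine ⟨k, ?_, ?_, ?_⟩
  · have := Nat.mul_pos hH hqp.pos
    omega
  · rintro ⟨h, z⟩
    ext
    · have := (Nat.ModEq.of_dvd (addOrderOf_dvd_natCard h) h1')
      simpa using (nsmul_eq_nsmul_iff_modEq.2 this)
    · simp only [Prod.smul_mk, nsmul_eq_mul]
      rw [(ZMod.natCast_eq_zero_iff k q).2 ((Nat.modEq_zero_iff_dvd).1 h0'), zero_mul]
  · intro d hd hqd
    have hdH : d ∣ Nat.card H :=
      Nat.Coprime.dvd_of_dvd_mul_right ((Nat.Prime.coprime_iff_not_dvd hqp).2 hqd).symm hd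
    have := (h1'.of_dvd hdH).gcd_eq
    simpa [Nat.Coprime] using this

/-- Translations by `T` do not change the second coordinate, so each layer of `B` tiles on its own.
-/
lemma IsTilingPair.slice {Z : Type*} [AddCommGroup Z] [Finite Z] [DecidableEq H] [DecidableEq Z]
    {B : Finset (H × Z)} {T : Finset H} (h : IsTilingPair B (T.image fun t => (t, (0 : Z)))) (z : Z) :
    IsTilingPair ((B.filter fun b => b.2 = z).image Prod.fst) T := by
  intro g
  obtain ⟨⟨b, t⟩, ⟨hb, ht, e⟩, hu⟩ := h (g, z)
  simp only at hb ht e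
  obtain ⟨t, ht', rfl⟩ := mem_image.1 ht
  obtain ⟨e1, e2⟩ := Prod.ext_iff.1 e
  simp only [Prod.fst_add, Prod.snd_add, add_zero] at e1 e2
  refine ⟨(b.1, t), ⟨mem_image_of_mem _ (mem_filter.2 ⟨hb, e2⟩), ht', e1⟩, ?_⟩
  rintro ⟨x, t'⟩ ⟨hx, ht'', e'⟩
  obtain ⟨b', hb', rfl⟩ := mem_image.1 hx
  obtain ⟨hb'', e3⟩ := mem_filter.1 hb'
  simp only at ht'' e'
  have := hu (b', (t', 0)) ⟨hb'', mem_image_of_mem _ ht'', Prod.ext (by simpa using e')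
    (by simpa using e3)⟩
  simp only [Prod.mk.injEq, and_true] at this
  rw [this.1, this.2]

/-- As q divides |B| · |T| exactly once, it is prime to one factor. If q divides |T|, the projection
of B tiles with the layer of T over 0, and characters of `H` are enough. Otherwise all layers of B
tile with the projection of T, and their common spectrum is multiplied by all characters of `ZMod
q`. -/
lemma HasUniversalSpectra.prod_zmod (hH : HasUniversalSpectra H) {q : ℕ} [Fact q.Prime]
    (hq : ¬ q ∣ Nat.card H) : HasUniversalSpectra (H × ZMod q) := by
  classical
  cases nonempty_fintype H
  have hqp : q.Prime := Fact.out
  obtain ⟨k, hk0, hk, hkd⟩ := exists_nsmul_eq_fst hq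
  have hcard : Nat.card (H × ZMod q) = Nat.card H * q := by simp
  let ι : H → H × ZMod q := fun t => (t, 0)
  have hι : Function.Injective ι := fun _ _ e => congrArg Prod.fst e
  have himg : ∀ S : Finset (H × ZMod q), S.image (k • ·) = (S.image Prod.fst).image ι := by
    intro S
    ext x
    simp only [mem_image, hk, exists_exists_and_eq_and, ι]
  intro T
  by_cases hqT : q ∣ T.card
  · let T₀ : Finset H := univ.filter fun h => (h, (0 : ZMod q)) ∈ T
    obtain ⟨Λ, hΛ⟩ := hH T₀
    refine ⟨Λ.image fun χ => χ.compAddMonoidHom (AddMonoidHom.fst H (ZMod q)), fun B hB => ?_⟩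
    have hqB : ¬ q ∣ B.card := by
      intro hqB
      have := mul_dvd_mul hqB hqT
      rw [hB.card_mul, hcard] at this
      exact hq (Nat.dvd_of_mul_dvd_mul_right hqp.pos this)
    have hB1 := hB.symm.image_nsmul hk0 (hkd _
      (by rw [← hcard, ← hB.card_mul]; exact dvd_mul_right _ _) hqB)
    have hc1 : (B.image Prod.fst).card = B.card := by
      have := hB1.card_mul.trans hB.symm.card_mul.symm
      rw [himg, card_image_of_injective _ hι] at this
      exact Nat.eq_of_mul_eq_mul_left (card_pos.2 hB.symm.nonempty) this
    rw [himg] at hB1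
    have hB2 := (hB1.slice 0).symm
    have hT₀ : (T.filter fun b => b.2 = 0).image Prod.fst = T₀ := by
      ext h
      simp [T₀]
    rw [hT₀] at hB2
    obtain ⟨hc, ho⟩ := hΛ _ hB2
    refine ⟨?_, ?_⟩
    · rw [card_image_of_injective, hc, hc1]
      exact AddChar.compAddMonoidHom_injective_left _ Prod.fst_surjective
    · intro χ' hχ' ψ' hψ' hne
      obtain ⟨χ, hχ, rfl⟩ := mem_image.1 hχ'
      obtain ⟨ψ, hψ, rfl⟩ := mem_image.1 hψ'
      have := ho χ hχ ψ hψ (fun e => hne (by rw [e]))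
      rw [charSum, sum_image (card_image_iff.1 hc1)] at this
      rw [← AddChar.sub_compAddMonoidHom]
      exact this
  · obtain ⟨Λ, hΛ⟩ := hH (T.image Prod.fst)
    let F : AddChar H ℂ × AddChar (ZMod q) ℂ → AddChar (H × ZMod q) ℂ := fun x =>
      x.1.compAddMonoidHom (AddMonoidHom.fst H (ZMod q)) +
        x.2.compAddMonoidHom (AddMonoidHom.snd H (ZMod q))
    have hF : ∀ x h z, F x (h, z) = x.1 h * x.2 z := fun x h z => rfl
    have hFi : Function.Injective F := by
      rintro ⟨a, b⟩ ⟨a', b'⟩ e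
      ext h
      · simpa [hF] using DFunLike.congr_fun e (h, 0)
      · simpa [hF] using DFunLike.congr_fun e (0, h)
    refine ⟨(Λ ×ˢ univ).image F, fun B hB => ?_⟩
    have hB1 := hB.image_nsmul hk0 (hkd _
      (by rw [← hcard, ← hB.card_mul]; exact dvd_mul_left _ _) hqT)
    have hc1 : (T.image Prod.fst).card = T.card := by
      have := hB1.card_mul.trans hB.card_mul.symm
      rw [himg, card_image_of_injective _ hι] at this
      exact Nat.eq_of_mul_eq_mul_left (card_pos.2 hB.nonempty) this
    rw [himg] at hB1
    have hs := hB1.slice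
    have hΛc : Λ.card * q = B.card := by
      have h1 := (hs 0).card_mul
      rw [← (hΛ _ (hs 0)).1, hc1] at h1
      have h2 := hB.card_mul
      rw [hcard, ← h1] at h2
      have h3 := card_pos.2 hB.symm.nonempty
      refine Nat.eq_of_mul_eq_mul_right h3 ?_
      rw [h2]; ring
    refine ⟨?_, ?_⟩
    · rw [card_image_of_injective _ hFi, card_product, card_univ, AddChar.card_eq, ZMod.card, hΛc]
    · intro χ' hχ' ψ' hψ' hne
      obtain ⟨⟨χ, η⟩, hχ, rfl⟩ := mem_image.1 hχ'
      obtain ⟨⟨ψ, θ⟩, hψ, rfl⟩ := mem_image.1 hψ'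
      simp only [mem_product, mem_univ, and_true] at hχ hψ
      have hsub : F (χ, η) - F (ψ, θ) = F (χ - ψ, η - θ) := by
        ext ⟨h, z⟩
        simp only [AddChar.sub_apply', hF]
        rw [mul_div_mul_comm]
      have hsum : charSum B (F (χ - ψ, η - θ)) = ∑ z, (η - θ) z *
          charSum ((B.filter fun b => b.2 = z).image Prod.fst) (χ - ψ) := by
        rw [charSum, ← Finset.sum_fiberwise B Prod.snd]
        refine Finset.sum_congr rfl fun z _ => ?_
        rw [charSum, sum_image, Finset.mul_sum]
        · refine Finset.sum_congr rfl fun b hb => ?_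
          obtain ⟨h, z'⟩ := b
          simp only [mem_filter] at hb
          rw [hF, ← hb.2, mul_comm]
        · rintro ⟨a, b⟩ h1 ⟨c, d⟩ h2 e
          simp only [coe_filter, Set.mem_ofPred_eq] at h1 h2
          exact Prod.ext e (h1.2.trans h2.2.symm)
      rw [hsub, hsum]
      by_cases hχψ : χ = ψ
      · subst hχψ
        have hηθ : η - θ ≠ 0 := fun e => hne (by rw [sub_eq_zero.1 e])
        -- All layers have the same number of points, so a nontrivial character of `ZMod q` sums to
        -- zero over them.
        simp only [sub_self, charSum_zero]
        have : ∀ z, (((B.filter fun b => b.2 = z).image Prod.fst).card : ℂ) = Λ.card :=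
          fun z => by rw [(hΛ _ (hs z)).1]
        simp only [this]
        rw [← Finset.sum_mul, AddChar.sum_eq_zero_iff_ne_zero.2 hηθ, zero_mul]
      · exact Finset.sum_eq_zero fun z _ => by rw [(hΛ _ (hs z)).2 χ hχ ψ hψ hχψ, mul_zero]

end Product

lemma HasUniversalSpectra.prod_zmod_of_squarefree {H : Type*} [AddCommGroup H] [Finite H]
    (hH : HasUniversalSpectra H) (m : ℕ) (h0 : NeZero m) (hm : Squarefree m)
    (hco : (Nat.card H).Coprime m) : HasUniversalSpectra (H × ZMod m) := by
  revert H h0 hm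
  induction m using Nat.recOnMul with
  | zero =>
    intro H _ _ _ h0
    exact absurd rfl h0.out
  | one =>
    intro H _ _ hH _ _ _
    exact hH.of_injective (AddMonoidHom.fst H (ZMod 1)) fun x y e =>
      Prod.ext e (Subsingleton.elim _ _)
  | prime p hp =>
    intro H _ _ hH _ _ hco
    have : Fact p.Prime := ⟨hp⟩
    exact hH.prod_zmod ((Nat.Prime.coprime_iff_not_dvd hp).1 (Nat.Coprime.symm hco))
  | mul a b iha ihb =>
    intro H _ _ hH h0 hm hco
    have hab := Nat.coprime_of_squarefree_mul hm
    have ha : NeZero a := ⟨fun e => h0.out (by simp [e])⟩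
    have hb : NeZero b := ⟨fun e => h0.out (by simp [e])⟩
    have h1 := iha hH ha hm.of_mul_left (Nat.Coprime.coprime_mul_right_right hco)
    have h2 := ihb h1 hb hm.of_mul_right (by
      rw [Nat.card_prod, Nat.card_zmod]
      exact Nat.Coprime.mul_left (Nat.Coprime.coprime_mul_left_right hco) hab)
    let e : ZMod (a * b) ≃+ ZMod a × ZMod b := (ZMod.chineseRemainder hab).toAddEquiv
    let f : H × ZMod (a * b) →+ (H × ZMod a) × ZMod b :=
      (AddEquiv.prodAssoc.symm.toAddMonoidHom).comp ((AddMonoidHom.id H).prodMap e.toAddMonoidHom)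
    refine h2.of_injective f ?_
    exact AddEquiv.prodAssoc.symm.injective.comp
      (Function.Injective.prodMap Function.injective_id e.injective)

/-! ### Galois conjugation of zeros of the transform -/

section Galois

/-- The roots ζ and ζ ^ k have the same minimal polynomial over the integers, and it divides the
polynomial with exponents `a i`. -/
lemma sum_pow_eq_zero_of_coprime {ι : Type*} (s : Finset ι) (a : ι → ℕ) {n k : ℕ} (hn : 0 < n)
    {ζ : ℂ} (hζ : IsPrimitiveRoot ζ n) (hk : k.Coprime n) (h : ∑ i ∈ s, ζ ^ a i = 0) :
    ∑ i ∈ s, (ζ ^ k) ^ a i = 0 := by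
  let P : Polynomial ℤ := ∑ i ∈ s, Polynomial.X ^ a i
  have hP : ∀ z : ℂ, Polynomial.aeval z P = ∑ i ∈ s, z ^ a i := fun z => by simp [P]
  have h1 : minpoly ℤ ζ ∣ P :=
    minpoly.isIntegrallyClosed_dvd (hζ.isIntegral hn) (by rw [hP, h])
  rw [hζ.minpoly_eq_pow_coprime hk] at h1
  obtain ⟨Q, hQ⟩ := h1
  rw [← hP, hQ, map_mul, minpoly.aeval, zero_mul]

variable {G : Type*} [AddCommGroup G] [Finite G]

lemma charSum_nsmul_eq_zero {T : Finset G} {χ : AddChar G ℂ} {k : ℕ} (hk : k.Coprime (Nat.card G))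
    (h : charSum T χ = 0) : charSum T (k • χ) = 0 := by
  set n := Nat.card G with hn
  have hn0 : 0 < n := Nat.card_pos
  have hζ := Complex.isPrimitiveRoot_exp n hn0.ne'
  have hroot : ∀ g, ∃ a, Complex.exp (2 * Real.pi * Complex.I / n) ^ a = χ g := by
    intro g
    have h1 : χ g ^ n = 1 := by
      rw [← AddChar.map_nsmul_eq_pow, hn, card_nsmul_eq_zero', AddChar.map_zero_eq_one]
    have : NeZero n := ⟨hn0.ne'⟩
    obtain ⟨a, -, ha⟩ := hζ.eq_pow_of_pow_eq_one h1
    exact ⟨a, ha⟩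
  choose a ha using hroot
  have := sum_pow_eq_zero_of_coprime T a hn0 hζ hk (by simpa [ha, charSum] using h)
  rw [charSum, ← this]
  refine Finset.sum_congr rfl fun t _ => ?_
  rw [AddChar.nsmul_apply, ← ha t, ← pow_mul, ← pow_mul, mul_comm k]

lemma charSum_zsmul_eq_zero {T : Finset G} {χ : AddChar G ℂ} {k : ℤ}
    (hk : IsCoprime k (Nat.card G : ℤ)) (h : charSum T χ = 0) : charSum T (k • χ) = 0 := by
  obtain ⟨m, rfl | rfl⟩ := k.eq_nat_or_neg
  · rw [natCast_zsmul]
    exact charSum_nsmul_eq_zero (Nat.isCoprime_iff_coprime.1 hk) h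
  · rw [neg_smul, natCast_zsmul, charSum_neg_eq_zero]
    exact charSum_nsmul_eq_zero (Nat.isCoprime_iff_coprime.1 ((IsCoprime.neg_left_iff _ _).1 hk)) h

end Galois

/-! ### Fourier inversion and convolution -/

section Inversion

variable {G Q : Type*} [AddCommGroup G] [AddCommGroup Q]

/-- Fourier inversion along a homomorphism. -/
lemma card_mul_sum_fiber {ι : Type*} [Fintype Q] [DecidableEq Q] (T : Finset ι) (f : ι → ℂ)
    (Φ : ι → Q) (q : Q) :
    (Fintype.card Q : ℂ) * ∑ t ∈ T with Φ t = q, f t =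
      ∑ χ : AddChar Q ℂ, χ (-q) * ∑ t ∈ T, f t * χ (Φ t) := by
  simp_rw [Finset.mul_sum]
  rw [Finset.sum_comm, Finset.sum_filter]
  refine Finset.sum_congr rfl fun t _ => ?_
  have : ∀ χ : AddChar Q ℂ, χ (-q) * (f t * χ (Φ t)) = f t * χ (Φ t - q) := fun χ => by
    rw [sub_eq_add_neg, AddChar.map_add_eq_mul]; ring
  simp_rw [this]
  rw [← Finset.mul_sum, AddChar.sum_apply_eq_ite]
  simp only [sub_eq_zero]
  split_ifs <;> ring

lemma sum_fiber_eq_zero {ι : Type*} [Fintype Q] [DecidableEq Q] {T : Finset ι} {f : ι → ℂ} {Φ : ι → Q}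
    (h : ∀ χ : AddChar Q ℂ, ∑ t ∈ T, f t * χ (Φ t) = 0) (q : Q) :
    ∑ t ∈ T with Φ t = q, f t = 0 := by
  have := card_mul_sum_fiber T f Φ q
  simp only [h, mul_zero, Finset.sum_const_zero] at this
  exact (mul_eq_zero.1 this).resolve_left (by exact_mod_cast Fintype.card_ne_zero)

lemma card_fiber_of_charSum_eq_zero [Fintype Q] [DecidableEq Q] {T : Finset G} {Φ : G →+ Q}
    (h : ∀ χ : AddChar Q ℂ, χ ≠ 0 → charSum T (χ.compAddMonoidHom Φ) = 0) (q : Q) :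
    Fintype.card Q * (T.filter fun t => Φ t = q).card = T.card := by
  have h1 : ∑ χ : AddChar Q ℂ, χ (-q) * ∑ t ∈ T, 1 * χ (Φ t) = T.card := by
    rw [Finset.sum_eq_single 0]
    · simp
    · intro χ _ hχ
      have := h χ hχ
      simp only [charSum, AddChar.compAddMonoidHom_apply] at this
      simp [this]
    · simp
  have := card_mul_sum_fiber T (fun _ => 1) Φ q
  rw [h1, Finset.sum_const, nsmul_eq_mul, mul_one] at this
  exact_mod_cast this

/-- Convolution of `charSum T` with itself along the characters of a quotient separating `T`. -/
lemma sum_charSum_mul_charSum [Fintype Q] {T : Finset G} {Φ : G →+ Q}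
    (hΦ : Set.InjOn Φ T) (x z : AddChar G ℂ) :
    ∑ w : AddChar Q ℂ, charSum T (x + w.compAddMonoidHom Φ) *
      charSum T (z - (x + w.compAddMonoidHom Φ)) = Fintype.card Q * charSum T z := by
  classical
  have h1 : ∀ w : AddChar Q ℂ, charSum T (x + w.compAddMonoidHom Φ) *
      charSum T (z - (x + w.compAddMonoidHom Φ)) =
      ∑ t ∈ T, ∑ u ∈ T, x (t - u) * z u * w (Φ t - Φ u) := by
    intro w
    rw [charSum, charSum, Finset.sum_mul_sum]
    refine Finset.sum_congr rfl fun t _ => Finset.sum_congr rfl fun u _ => ?_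
    simp only [AddChar.sub_apply', AddChar.add_apply, AddChar.compAddMonoidHom_apply,
      AddChar.map_sub_eq_div]
    rw [div_eq_mul_inv, mul_inv]
    ring
  simp_rw [h1]
  rw [Finset.sum_comm, charSum, Finset.mul_sum]
  refine Finset.sum_congr rfl fun t ht => ?_
  rw [Finset.sum_comm, Finset.sum_eq_single t]
  · rw [← Finset.mul_sum, sub_self, sub_self, AddChar.sum_apply_eq_ite]
    simp [mul_comm]
  · intro u hu hut
    rw [← Finset.mul_sum, AddChar.sum_apply_eq_ite, if_neg, mul_zero]
    exact fun e => hut (hΦ hu ht (sub_eq_zero.1 e).symm)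
  · exact fun h => (h ht).elim

end Inversion

/-! ### One-point factors and existence of nonzeros -/

section Trivial

variable {G : Type*} [AddCommGroup G]

/-- `Λ` has the right size and its differences avoid the zeros of the transform of `T`. -/
def IsSpectralFor (B T : Finset G) (Λ : Finset (AddChar G ℂ)) : Prop :=
  Λ.card = B.card ∧ ∀ χ ∈ Λ, ∀ ψ ∈ Λ, χ ≠ ψ → charSum T (χ - ψ) ≠ 0

lemma exists_isSpectralFor_of_card_eq_one [Finite G] {B T : Finset G} (h : IsTilingPair B T)
    (hT : T.card = 1) : ∃ Λ, IsSpectralFor B T Λ := by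
  cases nonempty_fintype G
  obtain ⟨t, rfl⟩ := card_eq_one.1 hT
  refine ⟨univ, ?_, fun χ _ ψ _ _ => ?_⟩
  · rw [card_univ, AddChar.card_eq, ← Nat.card_eq_fintype_card, ← h.card_mul]
    simp
  · simpa [charSum] using (AddChar.val_isUnit (χ - ψ) t).ne_zero

lemma exists_isSpectralFor_of_card_eq_one' {B T : Finset G} (hB : B.card = 1) :
    ∃ Λ, IsSpectralFor B T Λ :=
  ⟨{0}, by simp [hB], by simp⟩

/-- Otherwise inversion makes T equidistributed over `G`, so T is all of `G` and B is a point. -/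
lemma exists_charSum_ne_zero [Finite G] {B T : Finset G} (h : IsTilingPair B T) (hB : 1 < B.card) :
    ∃ χ : AddChar G ℂ, χ ≠ 0 ∧ charSum T χ ≠ 0 := by
  classical
  cases nonempty_fintype G
  by_contra! hc
  obtain ⟨t, ht⟩ := h.symm.nonempty
  have := card_fiber_of_charSum_eq_zero (Φ := AddMonoidHom.id G) (T := T)
    (fun χ hχ => hc χ hχ) t
  have h1 : (T.filter fun s => AddMonoidHom.id G s = t).card = 1 := by
    rw [card_eq_one]
    exact ⟨t, by ext s; simp; rintro rfl; exact ht⟩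
  rw [h1, mul_one, ← Nat.card_eq_fintype_card, ← h.card_mul] at this
  have h2 := card_pos.2 h.symm.nonempty
  nlinarith

end Trivial

/-! ### Characters with values in a half circle -/

section HalfCircle

/-- The half-open upper half plane: it contains exactly one of `z`, `-z` for `z ≠ 0`. -/
def UpperHalf (z : ℂ) : Prop := 0 < z.im ∨ (z.im = 0 ∧ 0 < z.re)

lemma upperHalf_neg {z : ℂ} (hz : z ≠ 0) : UpperHalf (-z) ↔ ¬ UpperHalf z := by
  have : z.im = 0 → z.re ≠ 0 := fun h1 h2 => hz (Complex.ext h2 h1)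
  simp only [UpperHalf, Complex.neg_im, Complex.neg_re, Left.neg_pos_iff, neg_eq_zero]
  rcases lt_trichotomy z.im 0 with h | h | h
  · simp [h, h.ne, h.not_gt]
  · have := this h
    rcases lt_or_gt_of_ne this with h' | h'
    · simp [h, h', h'.le]
    · simp [h, h', h'.le]
  · simp [h, h.ne', h.not_gt]

variable {G : Type*} [AddCommGroup G]

lemma AddChar.apply_ne_zero (χ : AddChar G ℂ) (g : G) : χ g ≠ 0 := (χ.val_isUnit g).ne_zero

lemma UpperHalf.sub_apply_ne_neg_one {χ ψ : AddChar G ℂ} {g : G} (hχ : UpperHalf (χ g))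
    (hψ : UpperHalf (ψ g)) : (χ - ψ) g ≠ -1 := by
  intro h
  rw [AddChar.sub_apply', div_eq_iff (ψ.apply_ne_zero g), neg_one_mul] at h
  rw [h, upperHalf_neg (ψ.apply_ne_zero g)] at hχ
  exact hχ hψ

-- Translation by ψ negates the value at b and so exchanges the two halves.
open Classical in
lemma two_mul_card_filter_upperHalf {S : Finset (AddChar G ℂ)} {ψ : AddChar G ℂ} {b : G}
    (hS : ∀ χ ∈ S, χ + ψ ∈ S) (hψ : ψ b = -1) :
    2 * (S.filter fun χ => UpperHalf (χ b)).card = S.card := by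
  have hb : ∀ χ : AddChar G ℂ, (χ + ψ) b = -χ b := fun χ => by simp [hψ]
  have h1 : (S.filter fun χ => UpperHalf (χ b)).card ≤
      (S.filter fun χ => ¬ UpperHalf (χ b)).card := by
    refine card_le_card_of_injOn (· + ψ) ?_ (add_left_injective ψ).injOn
    intro χ hχ
    obtain ⟨h1, h2⟩ := mem_filter.1 (mem_coe.1 hχ)
    refine mem_coe.2 (mem_filter.2 ⟨hS χ h1, ?_⟩)
    rw [hb, upperHalf_neg (χ.apply_ne_zero b)]
    exact not_not.2 h2
  have h2 : (S.filter fun χ => ¬ UpperHalf (χ b)).card ≤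
      (S.filter fun χ => UpperHalf (χ b)).card := by
    refine card_le_card_of_injOn (· + ψ) ?_ (add_left_injective ψ).injOn
    intro χ hχ
    obtain ⟨h1, h2⟩ := mem_filter.1 (mem_coe.1 hχ)
    refine mem_coe.2 (mem_filter.2 ⟨hS χ h1, ?_⟩)
    rw [hb, upperHalf_neg (χ.apply_ne_zero b)]
    exact h2
  have h3 := card_filter_add_card_filter_not (s := S) (fun χ => UpperHalf (χ b))
  omega

/-- Take a character of the quotient by `H` that is nontrivial at b and double it until just before
its value at b becomes 1; that last value is a square root of 1 other than 1. -/
lemma exists_apply_eq_neg_one [Finite G] {k : ℕ} (hG : ∀ g : G, 2 ^ k • g = 0) (H : AddSubgroup G)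
    {b : G} (hb : b ∉ H) : ∃ ψ : AddChar G ℂ, (∀ h ∈ H, ψ h = 1) ∧ ψ b = -1 := by
  have hb' : (QuotientAddGroup.mk b : G ⧸ H) ≠ 0 := by
    rwa [Ne, QuotientAddGroup.eq_zero_iff]
  obtain ⟨χ, hχ⟩ := AddChar.exists_apply_ne_zero.2 hb'
  set χ' : AddChar G ℂ := χ.compAddMonoidHom (QuotientAddGroup.mk' H) with hχ'
  have hb1 : χ' b ≠ 1 := hχ
  have hH : ∀ h ∈ H, χ' h = 1 := fun h hh => by
    simp [hχ', (QuotientAddGroup.eq_zero_iff h).2 hh]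
  have hex : ∃ j, χ' b ^ 2 ^ j = 1 := ⟨k, by rw [← AddChar.map_nsmul_eq_pow, hG]; simp⟩
  classical
  obtain ⟨i, hi⟩ : ∃ i, Nat.find hex = i + 1 := by
    refine Nat.exists_eq_succ_of_ne_zero fun h0 => hb1 ?_
    have := Nat.find_spec hex
    rwa [h0, pow_zero, pow_one] at this
  refine ⟨2 ^ i • χ', fun h hh => by simp [hH h hh], ?_⟩
  have h1 := Nat.find_spec hex
  have h2 := Nat.find_min hex (show i < Nat.find hex by omega)
  rw [hi, pow_succ, pow_mul, pow_two, mul_self_eq_one_iff] at h1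
  simpa using h1.resolve_left h2

end HalfCircle

/-! ### Two-point factors and four-point tiles -/

section TwoGroup

variable {G : Type*} [AddCommGroup G] [Finite G]

/-- The transform of {s, t} vanishes exactly where the value at t - s is -1, which is never the
ratio of two values in one half circle. Half of all characters take their value in it. -/
lemma exists_isSpectralFor_of_card_eq_two {k : ℕ} (hG : ∀ g : G, 2 ^ k • g = 0) {B T : Finset G}
    (h : IsTilingPair B T) (hT : T.card = 2) : ∃ Λ, IsSpectralFor B T Λ := by
  classical
  cases nonempty_fintype G
  obtain ⟨s, t, hst, rfl⟩ := card_eq_two.1 hT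
  obtain ⟨ψ, -, hψ⟩ := exists_apply_eq_neg_one hG ⊥ (b := t - s)
    (by simpa [sub_eq_zero] using hst.symm)
  refine ⟨univ.filter fun χ => UpperHalf (χ (t - s)), ?_, fun χ hχ ψ hψ _ => ?_⟩
  · have h1 := two_mul_card_filter_upperHalf (S := univ) (fun χ _ => mem_univ (χ + ψ)) hψ
    rw [card_univ, AddChar.card_eq, ← Nat.card_eq_fintype_card, ← h.card_mul, hT] at h1
    omega
  · have h1 := UpperHalf.sub_apply_ne_neg_one (mem_filter.1 hχ).2 (mem_filter.1 hψ).2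
    rw [charSum, sum_pair hst]
    intro h2
    apply h1
    rw [AddChar.map_sub_eq_div, div_eq_iff (AddChar.apply_ne_zero _ _)]
    linear_combination h2

lemma exists_isSpectralFor_of_card_eq_two' {B T : Finset G} (h : IsTilingPair B T)
    (hB : B.card = 2) : ∃ Λ, IsSpectralFor B T Λ := by
  classical
  obtain ⟨χ, hχ, hT⟩ := exists_charSum_ne_zero h (by omega)
  refine ⟨{0, χ}, by rw [card_pair hχ.symm, hB], ?_⟩
  have : charSum T (-χ) ≠ 0 := by rwa [Ne, charSum_neg_eq_zero]
  simp [hχ, hT, this]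

/-- A four-element spectrum from `x`, `z` and `x + z`, `x - z`. -/
lemma isSpectralFor_of_four {B T : Finset G} (hB : B.card = 4) {x z : AddChar G ℂ}
    (hx0 : x ≠ 0) (hz0 : z ≠ 0) (hxz : x ≠ z) (hxz' : x + z ≠ 0)
    (hx : charSum T x ≠ 0) (hz : charSum T z ≠ 0)
    (h1 : charSum T (z - x) ≠ 0) (h2 : charSum T (x + z) ≠ 0) : ∃ Λ, IsSpectralFor B T Λ := by
  classical
  have neg : ∀ {χ : AddChar G ℂ}, charSum T χ ≠ 0 → charSum T (-χ) ≠ 0 := fun h => by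
    rwa [Ne, charSum_neg_eq_zero]
  refine ⟨{0, x, z, x + z}, ?_, ?_⟩
  · rw [hB, card_insert_of_notMem, card_insert_of_notMem, card_pair]
    · simpa using hx0
    · simp [hxz, hz0]
    · simp [hx0.symm, hz0.symm, hxz'.symm]
  · have h1' : charSum T (x - z) ≠ 0 := by rw [← neg_sub]; exact neg h1
    have e1 : -z + -x = -(x + z) := by abel
    have h3 : charSum T (-z + -x) ≠ 0 := by rw [e1]; exact neg h2
    simp [hx, hz, h1, h2, neg hx, neg hz, h1', h3]

lemma exists_isSpectralFor_of_card_eq_four' {B T : Finset G} (h : IsTilingPair B T)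
    (hB : B.card = 4) {y : AddChar G ℂ} (hy0 : y ≠ 0) (hy2 : y + y = 0) (hy : charSum T y ≠ 0) :
    ∃ Λ, IsSpectralFor B T Λ := by
  classical
  cases nonempty_fintype G
  have hconv := sum_charSum_mul_charSum (T := T) (Φ := AddMonoidHom.id G)
    (fun _ _ _ _ e => e) 0 y
  have hid : ∀ w : AddChar G ℂ, 0 + w.compAddMonoidHom (AddMonoidHom.id G) = w := fun w => by
    ext; simp
  simp only [hid] at hconv
  obtain ⟨x, hx⟩ : ∃ x, x ≠ 0 ∧ x ≠ y ∧ charSum T x * charSum T (y - x) ≠ 0 := by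
    -- The terms at 0 and y give 2 |T| T^(y), only half of the total |G| T^(y) = 4 |T| T^(y).
    by_contra! hc
    rw [← Finset.sum_subset (subset_univ {0, y}), sum_pair hy0.symm, sub_zero, sub_self,
      charSum_zero, ← Nat.card_eq_fintype_card, ← h.card_mul, hB] at hconv
    · have hT : (T.card : ℂ) ≠ 0 := by exact_mod_cast (card_pos.2 h.symm.nonempty).ne'
      push_cast at hconv
      have : 2 * ((T.card : ℂ) * charSum T y) = 0 := by linear_combination -hconv
      simp [hT, hy] at this
    · intro x _ hx
      simp only [mem_insert, mem_singleton, not_or] at hx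
      exact hc x hx.1 hx.2
  obtain ⟨hx0, hxy, hp⟩ := hx
  have hyy : -y = y := neg_eq_of_add_eq_zero_left hy2
  have h1 : charSum T (y - x) ≠ 0 := right_ne_zero_of_mul hp
  refine isSpectralFor_of_four hB hx0 hy0 hxy ?_ (left_ne_zero_of_mul hp) hy h1 ?_
  · rw [Ne, add_eq_zero_iff_eq_neg, hyy]
    exact hxy
  · rw [← hyy, ← sub_eq_add_neg, Ne, charSum_sub_comm]
    exact h1

-- For x = x₀ + w and z = 2 x₀ + w', the last relation holds because 4 x + 2 z = 8 x₀ = 0. It makes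
-- z - x a Galois conjugate of x + z, so one nonzero of the transform yields the other.
omit [Finite G] in
lemma four_relations {x₀ w w' : G} (h4 : 4 • x₀ ≠ 0) (h8 : 8 • x₀ = 0) (hw : 2 • w = 0)
    (hw' : 2 • w' = 0) : x₀ + w ≠ 0 ∧ 2 • x₀ + w' ≠ 0 ∧ x₀ + w ≠ 2 • x₀ + w' ∧
      (x₀ + w) + (2 • x₀ + w') ≠ 0 ∧
      3 • ((x₀ + w) + (2 • x₀ + w')) = (2 • x₀ + w') - (x₀ + w) := by
  refine ⟨fun e => h4 ?_, fun e => h4 ?_, fun e => h4 ?_, fun e => h4 ?_, ?_⟩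
  · have : 4 • x₀ = 4 • (x₀ + w) - 2 • (2 • w) := by abel
    rw [this, e, hw]; simp
  · have : 4 • x₀ = 2 • (2 • x₀ + w') - (2 • w') := by abel
    rw [this, e, hw']; simp
  · have : 4 • x₀ = 4 • (2 • x₀ + w') - 4 • (x₀ + w) - 2 • (2 • w') + 2 • (2 • w) := by abel
    rw [this, e, hw, hw']; simp
  · have : 4 • x₀ = 2 • (8 • x₀) - 4 • ((x₀ + w) + (2 • x₀ + w')) + 2 • (2 • w) + 2 • (2 • w') := by
      abel
    rw [this, e, hw, hw', h8]; simp
  · have : 3 • ((x₀ + w) + (2 • x₀ + w')) =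
        (2 • x₀ + w') - (x₀ + w) + 8 • x₀ + 2 • (2 • w) + 2 • w' := by abel
    rw [this, h8, hw, hw']; simp

omit [Finite G] in
lemma exists_charSum_add_ne_zero {Q : Type*} [AddCommGroup Q] [Finite Q] {T : Finset G}
    (hT : T.Nonempty) {Φ : G →+ Q} (hΦ : Set.InjOn Φ T) (x : AddChar G ℂ) :
    ∃ w : AddChar Q ℂ, charSum T (x + w.compAddMonoidHom Φ) ≠ 0 := by
  classical
  cases nonempty_fintype Q
  obtain ⟨t₀, ht₀⟩ := hT
  by_contra! hc
  have h1 := sum_fiber_eq_zero (Q := Q) (T := T) (f := x) (Φ := Φ) (fun χ => hc χ) (Φ t₀)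
  rw [Finset.sum_eq_single t₀] at h1
  · exact AddChar.apply_ne_zero _ _ h1
  · intro s hs hne
    obtain ⟨hs, hs'⟩ := mem_filter.1 hs
    exact (hne (hΦ hs ht₀ hs')).elim
  · simp [ht₀]

/-- Inversion gives a nonzero z of T^ in the coset of 2 x₀ modulo characters of `Q`. The convolution
identity at z then gives x in the coset of x₀ with T^(x) and T^(z - x) nonzero, and conjugation by 3
handles x + z. -/
lemma exists_isSpectralFor_of_transversal {Q : Type*} [AddCommGroup Q] [Finite Q] {B T : Finset G}
    (h : IsTilingPair B T) (hB : B.card = 4) (h3 : Nat.Coprime 3 (Nat.card G)) {Φ : G →+ Q}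
    (hQ : ∀ q : Q, 2 • q = 0) (hΦ : Set.InjOn Φ T) {x₀ : AddChar G ℂ} (h4 : 4 • x₀ ≠ 0)
    (h8 : 8 • x₀ = 0) : ∃ Λ, IsSpectralFor B T Λ := by
  classical
  cases nonempty_fintype Q
  have h2w : ∀ w : AddChar Q ℂ, 2 • w.compAddMonoidHom Φ = 0 := fun w => by
    ext g
    rw [AddChar.nsmul_apply, AddChar.compAddMonoidHom_apply, ← AddChar.map_nsmul_eq_pow, hQ]
    simp
  obtain ⟨t₀, ht₀⟩ := h.symm.nonempty
  obtain ⟨w', hz⟩ := exists_charSum_add_ne_zero ⟨t₀, ht₀⟩ hΦ (2 • x₀)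
  generalize hzdef : 2 • x₀ + w'.compAddMonoidHom Φ = z at hz
  obtain ⟨w, hw⟩ : ∃ w : AddChar Q ℂ, charSum T (x₀ + w.compAddMonoidHom Φ) *
      charSum T (z - (x₀ + w.compAddMonoidHom Φ)) ≠ 0 := by
    by_contra! hc
    have h1 := sum_charSum_mul_charSum hΦ x₀ z
    simp only [hc, Finset.sum_const_zero] at h1
    exact mul_ne_zero (by exact_mod_cast Fintype.card_ne_zero) hz h1.symm
  obtain ⟨hx0, hz0, hxz, hxz', e⟩ := four_relations h4 h8 (h2w w) (h2w w')
  rw [hzdef] at hz0 hxz hxz' e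
  refine isSpectralFor_of_four hB hx0 hz0 hxz hxz' (left_ne_zero_of_mul hw) hz
    (right_ne_zero_of_mul hw) fun e' => right_ne_zero_of_mul hw ?_
  rw [← e]
  exact charSum_nsmul_eq_zero h3 e'

end TwoGroup

/-! ### Four-point factors and the case list for order 32 -/

section CardFour

/-- For unit numbers the second equation is the conjugate of the first: four unit vectors with sum
zero form two opposite pairs. Eliminating w leaves (1 + u)(1 + v)(u + v) = 0. -/
lemma eq_neg_of_four_sum_eq_zero {u v w : ℂ} (hu : u ≠ 0) (hv : v ≠ 0) (hw : w ≠ 0)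
    (h : 1 + u + v + w = 0) (h' : 1 + u⁻¹ + v⁻¹ + w⁻¹ = 0) : u = -1 ∨ v = -1 ∨ u = -v := by
  field_simp at h'
  have hw' : w = -(1 + u + v) := by linear_combination h
  subst hw'
  have : (1 + u) * ((1 + v) * (u + v)) = 0 := by linear_combination -h'
  rcases mul_eq_zero.1 this with h | h
  · exact Or.inl (by linear_combination h)
  · rcases mul_eq_zero.1 h with h | h
    · exact Or.inr (Or.inl (by linear_combination h))
    · exact Or.inr (Or.inr (by linear_combination h))

variable {G : Type*} [AddCommGroup G]

lemma charSum_eq_of_card_eq_four {T : Finset G} (hT : T.card = 4) {s x y z : G} (hs : s ∈ T)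
    (hx : x ∈ T) (hy : y ∈ T) (hz : z ∈ T) (hsx : s ≠ x) (hsy : s ≠ y) (hsz : s ≠ z) (hxy : x ≠ y)
    (hxz : x ≠ z) (hyz : y ≠ z) (χ : AddChar G ℂ) :
    charSum T χ = χ s * (1 + χ (x - s) + χ (y - s) + χ (z - s)) := by
  classical
  have hcard : ({s, x, y, z} : Finset G).card = 4 := by
    rw [card_insert_of_notMem, card_insert_of_notMem, card_pair hyz] <;> simp [*]
  have : T = {s, x, y, z} := by
    symm
    apply eq_of_subset_of_card_le
    · simp [insert_subset_iff, *]
    · rw [hT, hcard]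
  rw [this, charSum, sum_insert (by simp [*]), sum_insert (by simp [*]), sum_pair hyz]
  have := χ.apply_ne_zero s
  simp only [AddChar.map_sub_eq_div]
  field_simp
  ring

variable [Finite G]

/-- Confining the values at a and at b to a half circle keeps a quarter of the characters, as b is
independent enough of a for each condition to halve. Differences then avoid -1 at both points, and
`hab` removes the third way to vanish. -/
lemma exists_isSpectralFor_of_card_eq_four {k : ℕ} (hG : ∀ g : G, 2 ^ k • g = 0) {B T : Finset G}
    (h : IsTilingPair B T) (hT : T.card = 4) {s a b c : G}
    (hsum : ∀ χ : AddChar G ℂ, charSum T χ = χ s * (1 + χ a + χ b + χ c)) (ha : a ≠ 0)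
    (hb : b ∉ AddSubgroup.zmultiples a)
    (hab : ∀ χ : AddChar G ℂ, χ a = -χ b → χ a = -1 ∨ χ b = -1) : ∃ Λ, IsSpectralFor B T Λ := by
  classical
  cases nonempty_fintype G
  obtain ⟨ψ₁, -, hψ₁⟩ := exists_apply_eq_neg_one hG ⊥ (b := a) (by simpa using ha)
  obtain ⟨ψ₂, hψ₂, hψ₂'⟩ := exists_apply_eq_neg_one hG _ hb
  have hψ₂a := hψ₂ a (AddSubgroup.mem_zmultiples a)
  refine ⟨(univ.filter fun χ => UpperHalf (χ a)).filter fun χ => UpperHalf (χ b), ?_, ?_⟩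
  · have h1 := two_mul_card_filter_upperHalf (S := univ) (fun χ _ => mem_univ (χ + ψ₁)) hψ₁
    have h2 := two_mul_card_filter_upperHalf (S := univ.filter fun χ => UpperHalf (χ a))
      (ψ := ψ₂) (b := b) (fun χ hχ => by simpa [hψ₂a] using hχ) hψ₂'
    rw [card_univ, AddChar.card_eq, ← Nat.card_eq_fintype_card, ← h.card_mul, hT] at h1
    omega
  · intro χ hχ ψ hψ _ h0
    simp only [mem_filter, mem_univ, true_and] at hχ hψ
    have h1 := hχ.1.sub_apply_ne_neg_one hψ.1
    have h2 := hχ.2.sub_apply_ne_neg_one hψ.2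
    have h0' := charSum_neg_eq_zero.2 h0
    generalize χ - ψ = θ at h0 h0' h1 h2
    rw [hsum, mul_eq_zero] at h0 h0'
    have h3 := h0.resolve_left (θ.apply_ne_zero s)
    have h3' := h0'.resolve_left ((-θ).apply_ne_zero s)
    simp only [AddChar.neg_apply'] at h3'
    rcases eq_neg_of_four_sum_eq_zero (θ.apply_ne_zero _) (θ.apply_ne_zero _) (θ.apply_ne_zero _)
      h3 h3' with h4 | h4 | h4
    · exact h1 h4
    · exact h2 h4
    · exact (hab θ h4).elim h1 h2

/-- Here a = x - s has order 2, so χ a is 1 or -1, and χ a = -χ b forces one of the two values to be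
-1. -/
lemma exists_isSpectralFor_of_two_nsmul_eq {k : ℕ} (hG : ∀ g : G, 2 ^ k • g = 0) {B T : Finset G}
    (h : IsTilingPair B T) (hT : T.card = 4) {s x : G} (hs : s ∈ T) (hx : x ∈ T) (hne : x ≠ s)
    (h2 : 2 • x = 2 • s) : ∃ Λ, IsSpectralFor B T Λ := by
  classical
  obtain ⟨y, z, hyz, hT'⟩ : ∃ y z, y ≠ z ∧ (T.erase s).erase x = {y, z} := by
    rw [← card_eq_two, card_erase_of_mem (by simp [*]), card_erase_of_mem hs, hT]
  have hy : y ∈ (T.erase s).erase x := by simp [hT']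
  have hz : z ∈ (T.erase s).erase x := by simp [hT']
  simp only [mem_erase] at hy hz
  have h2a : 2 • (x - s) = 0 := by rw [smul_sub, h2, sub_self]
  refine exists_isSpectralFor_of_card_eq_four hG h hT
    (charSum_eq_of_card_eq_four hT hs hx hy.2.2 hz.2.2 hne.symm hy.2.1.symm hz.2.1.symm hy.1.symm
      hz.1.symm hyz) (sub_ne_zero.2 hne) ?_ ?_
  · rw [AddSubgroup.mem_zmultiples_iff]
    rintro ⟨j, hj⟩
    rcases Int.even_or_odd' j with ⟨i, rfl | rfl⟩
    · rw [mul_comm, mul_smul, ofNat_zsmul, h2a, smul_zero] at hj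
      exact hy.2.1 (sub_eq_zero.1 hj.symm)
    · rw [add_smul, mul_comm, mul_smul, ofNat_zsmul, h2a, smul_zero, zero_add, one_smul] at hj
      exact hy.1 (sub_left_injective hj).symm
  · intro χ hχ
    have h1 : χ (x - s) * χ (x - s) = 1 := by
      rw [← AddChar.map_add_eq_mul, ← two_nsmul, h2a, AddChar.map_zero_eq_one]
    rcases mul_self_eq_one_iff.1 h1 with h1 | h1
    · right
      rw [h1] at hχ
      linear_combination hχ
    · exact Or.inl h1

/-- The general arguments leave two cases: |T| = 4 with doubling injective on T, and |T| = 8 with T^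
zero at every character of order 2. -/
lemma hasUniversalSpectra_of_card_eq_thirtyTwo (hG : Nat.card G = 32)
    (hfour : ∀ B T : Finset G, IsTilingPair B T → T.card = 4 →
      (∀ s ∈ T, ∀ x ∈ T, 2 • x = 2 • s → x = s) → ∃ Λ, IsSpectralFor B T Λ)
    (height : ∀ B T : Finset G, IsTilingPair B T → B.card = 4 → T.card = 8 →
      (∀ y : AddChar G ℂ, y ≠ 0 → y + y = 0 → charSum T y = 0) → ∃ Λ, IsSpectralFor B T Λ) :
    HasUniversalSpectra G := by
  refine hasUniversalSpectra_of_forall fun B T h => ?_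
  have hG2 : ∀ g : G, 2 ^ 5 • g = 0 := fun g => by
    rw [show 2 ^ 5 = Nat.card G by rw [hG]; rfl]; exact card_nsmul_eq_zero'
  have hc : B.card * T.card = 32 := by rw [h.card_mul, hG]
  obtain ⟨j, hj, hTj⟩ := (Nat.dvd_prime_pow (m := 5) Nat.prime_two).1
    (show T.card ∣ 2 ^ 5 from ⟨B.card, by rw [mul_comm, hc]; rfl⟩)
  interval_cases j
  · exact exists_isSpectralFor_of_card_eq_one h (by simpa using hTj)
  · exact exists_isSpectralFor_of_card_eq_two hG2 h (by simpa using hTj)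
  · by_cases h2 : ∀ s ∈ T, ∀ x ∈ T, 2 • x = 2 • s → x = s
    · exact hfour B T h (by simpa using hTj) h2
    · push Not at h2
      obtain ⟨s, hs, x, hx, h2, hne⟩ := h2
      exact exists_isSpectralFor_of_two_nsmul_eq hG2 h (by simpa using hTj) hs hx hne h2
  · have hB : B.card = 4 := by rw [hTj] at hc; omega
    by_cases hy : ∀ y : AddChar G ℂ, y ≠ 0 → y + y = 0 → charSum T y = 0
    · exact height B T h hB (by simpa using hTj) hy
    · push Not at hy
      obtain ⟨y, hy0, hy2, hy⟩ := hy
      exact exists_isSpectralFor_of_card_eq_four' h hB hy0 hy2 hy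
  · exact exists_isSpectralFor_of_card_eq_two' h (by rw [hTj] at hc; omega)
  · exact exists_isSpectralFor_of_card_eq_one' (by rw [hTj] at hc; omega)

end CardFour

/-! ### The three groups of order 32 -/

section ThirtyTwo

lemma two_nsmul_zmod_two_pi {ι : Type*} (v : ι → ZMod 2) : 2 • v = 0 := by
  ext i
  have : ∀ a : ZMod 2, 2 • a = 0 := by decide
  exact this _

lemma hasUniversalSpectra_two_pow_five : HasUniversalSpectra (Fin 5 → ZMod 2) := by
  refine hasUniversalSpectra_of_card_eq_thirtyTwo (by simp) ?_ ?_
  · intro B T _ hT h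
    obtain ⟨s, hs, x, hx, hne⟩ := one_lt_card.1 (show 1 < T.card by omega)
    exact (hne (h x hx s hs (by rw [two_nsmul_zmod_two_pi, two_nsmul_zmod_two_pi]))).elim
  · intro B T h hB _ hy
    obtain ⟨χ, hχ, hT⟩ := exists_charSum_ne_zero h (by omega)
    refine (hT (hy χ hχ ?_)).elim
    ext g
    rw [AddChar.add_apply, ← AddChar.map_add_eq_mul, ← two_nsmul, two_nsmul_zmod_two_pi]
    simp

/-- Reduction modulo `k` of the first coordinate of `ZMod n × A`. -/
def castProd {n k : ℕ} (h : k ∣ n) (A : Type*) [AddCommGroup A] : ZMod n × A →+ ZMod k × A :=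
  (ZMod.castHom h (ZMod k)).toAddMonoidHom.prodMap (AddMonoidHom.id A)

/-- Characters of the quotient by doubling have order at most 2, so their vanishing equidistributes
T over that quotient. -/
lemma card_fiber_castProd {n r : ℕ} [NeZero n] (h : 2 ∣ n) {T : Finset (ZMod n × (Fin r → ZMod 2))}
    (hy : ∀ y : AddChar (ZMod n × (Fin r → ZMod 2)) ℂ, y ≠ 0 → y + y = 0 → charSum T y = 0)
    (q : ZMod 2 × (Fin r → ZMod 2)) :
    2 ^ (r + 1) * (T.filter fun t => castProd h (Fin r → ZMod 2) t = q).card = T.card := by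
  rw [← card_fiber_of_charSum_eq_zero (T := T) (Φ := castProd h (Fin r → ZMod 2)) ?_ q]
  · simp [pow_succ, mul_comm]
  · intro χ hχ
    have hsurj : Function.Surjective (castProd h (Fin r → ZMod 2)) :=
      Function.Surjective.prodMap (ZMod.castHom_surjective h) Function.surjective_id
    refine hy _ (fun e => hχ (AddChar.compAddMonoidHom_injective_left _ hsurj (e.trans ?_))) ?_
    · ext; simp
    · ext g
      have h2 : ∀ q : ZMod 2 × (Fin r → ZMod 2), q + q = 0 := fun q => by
        rw [← two_nsmul]
        refine Prod.ext ?_ (two_nsmul_zmod_two_pi _)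
        have : ∀ a : ZMod 2, 2 • a = 0 := by decide
        exact this _
      rw [AddChar.add_apply, AddChar.compAddMonoidHom_apply, ← AddChar.map_add_eq_mul, h2]
      simp

lemma hasUniversalSpectra_four_two_pow_three :
    HasUniversalSpectra (ZMod (2 ^ 2) × (Fin 3 → ZMod 2)) := by
  refine hasUniversalSpectra_of_card_eq_thirtyTwo (by simp) ?_ ?_
  · intro B T _ hT h
    have h1 : T.card ≤ ({0, 2} : Finset (ZMod (2 ^ 2))).card := by
      refine card_le_card_of_injOn (fun x => 2 • x.1) ?_ ?_
      · intro x _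
        have : ∀ a : ZMod (2 ^ 2), 2 • a ∈ ({0, 2} : Finset (ZMod (2 ^ 2))) := by decide
        exact this x.1
      · intro x hx y hy e
        refine h y hy x hx (Prod.ext e ?_)
        rw [Prod.smul_snd, Prod.smul_snd, two_nsmul_zmod_two_pi, two_nsmul_zmod_two_pi]
    have h2 := (card_le_two (a := (0 : ZMod (2 ^ 2))) (b := 2))
    omega
  · intro B T _ _ hT hy
    have := card_fiber_castProd (n := 2 ^ 2) (by norm_num) hy 0
    rw [hT] at this
    omega

lemma hasUniversalSpectra_eight_two_pow_two :
    HasUniversalSpectra (ZMod (2 ^ 3) × (Fin 2 → ZMod 2)) := by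
  refine hasUniversalSpectra_of_card_eq_thirtyTwo (by simp) ?_ ?_
  · intro B T h hT h2
    let Φ : ZMod (2 ^ 3) →+ ZMod 4 := (ZMod.castHom (by norm_num) (ZMod 4)).toAddMonoidHom
    -- The double of an element of `ZMod 8` depends only on its residue mod 4, so the four points of
    -- T represent all residues mod 4.
    have hΦ2 : ∀ a b : ZMod (2 ^ 3), Φ a = Φ b → 2 • a = 2 • b := by decide
    have hinj : Set.InjOn (fun x : ZMod (2 ^ 3) × (Fin 2 → ZMod 2) => Φ x.1) T := by
      intro x hx y hy e
      refine h2 y hy x hx (Prod.ext (hΦ2 _ _ e) ?_)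
      rw [Prod.smul_snd, Prod.smul_snd, two_nsmul_zmod_two_pi, two_nsmul_zmod_two_pi]
    have hsurj : ∀ q : ZMod 4, ∃ x ∈ T, Φ x.1 = q := by
      intro q
      have := surjOn_of_injOn_of_card_le (t := (univ : Finset (ZMod 4)))
        (fun x : ZMod (2 ^ 3) × (Fin 2 → ZMod 2) => Φ x.1) (fun _ _ => by simp) hinj
        (by rw [hT]; rfl)
      simpa using this (mem_coe.2 (mem_univ q))
    obtain ⟨s, hs, hs'⟩ := hsurj 0
    obtain ⟨x, hx, hx'⟩ := hsurj 2
    obtain ⟨y, hy, hy'⟩ := hsurj 1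
    obtain ⟨z, hz, hz'⟩ := hsurj 3
    have ne : ∀ {u v : ZMod (2 ^ 3) × (Fin 2 → ZMod 2)} {i j : ZMod 4}, Φ u.1 = i → Φ v.1 = j →
        i ≠ j → u ≠ v := by
      rintro u v i j rfl rfl hij rfl
      exact hij rfl
    have hx2 : Φ (x - s).1 = 2 := by rw [Prod.fst_sub, map_sub, hx', hs']; rfl
    have hy1 : Φ (y - s).1 = 1 := by rw [Prod.fst_sub, map_sub, hy', hs']; rfl
    refine exists_isSpectralFor_of_card_eq_four (k := 5) (fun g => ?_) h hT
      (charSum_eq_of_card_eq_four hT hs hx hy hz (ne hs' hx' (by decide)) (ne hs' hy' (by decide))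
        (ne hs' hz' (by decide)) (ne hx' hy' (by decide)) (ne hx' hz' (by decide))
        (ne hy' hz' (by decide)))
      (sub_ne_zero.2 (ne hx' hs' (by decide))) ?_ ?_
    · rw [show 2 ^ 5 = Nat.card (ZMod (2 ^ 3) × (Fin 2 → ZMod 2)) by simp]
      exact card_nsmul_eq_zero'
    · rw [AddSubgroup.mem_zmultiples_iff]
      rintro ⟨j, hj⟩
      have h1 : j • Φ (x - s).1 = Φ (y - s).1 := by
        rw [← hj, Prod.smul_fst, map_zsmul]
      rw [hx2, hy1, zsmul_eq_mul] at h1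
      have : ∀ a : ZMod 4, a * 2 ≠ 1 := by decide
      exact this _ h1
    · intro χ hχ
      -- With a = x - s and b = y - s these relations turn χ a = -χ b into χ a ^ 2 = χ b ^ 4 = χ a ^
      -- 4 = 1.
      have h4 : ∀ a b : ZMod (2 ^ 3), Φ a = 2 → Φ b = 1 → 2 • a = 4 • b ∧ 4 • a = 0 := by decide
      obtain ⟨e1, e2⟩ := h4 _ _ hx2 hy1
      have e1' : 2 • (x - s) = 4 • (y - s) := by
        refine Prod.ext e1 ?_
        rw [Prod.smul_snd, Prod.smul_snd, two_nsmul_zmod_two_pi, show 4 = 2 * 2 from rfl, mul_smul,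
          two_nsmul_zmod_two_pi]
      have e2' : 4 • (x - s) = 0 := by
        refine Prod.ext e2 ?_
        rw [Prod.smul_snd, show 4 = 2 * 2 from rfl, mul_smul, two_nsmul_zmod_two_pi]
        rfl
      have f1 : χ (x - s) ^ 4 = 1 := by rw [← AddChar.map_nsmul_eq_pow, e2', AddChar.map_zero_eq_one]
      have f2 : χ (x - s) ^ 2 = χ (y - s) ^ 4 := by
        rw [← AddChar.map_nsmul_eq_pow, ← AddChar.map_nsmul_eq_pow, e1']
      have f3 : χ (x - s) * χ (x - s) = 1 := by
        rw [← pow_two, f2, ← f1, hχ]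
        ring
      rcases mul_self_eq_one_iff.1 f3 with f3 | f3
      · right
        rw [f3] at hχ
        linear_combination hχ
      · exact Or.inl f3
  · intro B T h hB hT hy
    have hdvd : 2 ∣ 2 ^ 3 := by norm_num
    have hfib := card_fiber_castProd (n := 2 ^ 3) hdvd hy
    -- Equidistribution of 8 points over 8 classes leaves one in each, so T is a transversal; x₀
    -- below is a character of order 8.
    have hinj : Set.InjOn (castProd hdvd (Fin 2 → ZMod 2)) T := by
      intro x hx y hy e
      have h1 := hfib (castProd hdvd (Fin 2 → ZMod 2) y)
      rw [hT] at h1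
      have h2 : (T.filter fun t => castProd hdvd (Fin 2 → ZMod 2) t =
        castProd hdvd (Fin 2 → ZMod 2) y).card ≤ 1 := by omega
      exact card_le_one.1 h2 x (mem_filter.2 ⟨hx, e⟩) y (mem_filter.2 ⟨hy, rfl⟩)
    let x₀ : AddChar (ZMod (2 ^ 3) × (Fin 2 → ZMod 2)) ℂ :=
      (ZMod.stdAddChar (N := 2 ^ 3)).compAddMonoidHom (AddMonoidHom.fst _ _)
    have hx₀ : ∀ (k : ℕ) (g : ZMod (2 ^ 3) × (Fin 2 → ZMod 2)),
        (k • x₀) g = ZMod.stdAddChar (k • g.1) := fun k g => by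
      rw [AddChar.nsmul_apply, AddChar.map_nsmul_eq_pow]; rfl
    refine exists_isSpectralFor_of_transversal h hB (by simp; norm_num) (fun q => ?_) hinj (x₀ := x₀) ?_ ?_
    · refine Prod.ext ?_ (two_nsmul_zmod_two_pi _)
      have : ∀ a : ZMod 2, 2 • a = 0 := by decide
      exact this _
    · intro e
      have := DFunLike.congr_fun e (1, 0)
      rw [hx₀, AddChar.zero_apply, ← AddChar.map_zero_eq_one (ZMod.stdAddChar (N := 2 ^ 3))] at this
      have := ZMod.injective_stdAddChar this
      revert this
      decide
    · ext g
      rw [hx₀]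
      have : ∀ a : ZMod (2 ^ 3), 8 • a = 0 := by decide
      rw [this]
      simp

end ThirtyTwo

/-! ### Elementary abelian groups of rank three -/

section ElementaryAbelian

variable {G : Type*} [AddCommGroup G] [Finite G] {p : ℕ} [Fact p.Prime]

/-- The spectrum is the annihilator of t - s for two points s, t of T. A zero θ of T^ has all its
multiples jθ, 0 < j < p, as zeros, so θ takes each value once on the p points of T. This contradicts
θ s = θ t. -/
lemma exists_isSpectralFor_of_card_eq_prime (hG : ∀ g : G, p • g = 0) {B T : Finset G}
    (h : IsTilingPair B T) (hT : T.card = p) {k : ℕ} (hk : Nat.card G = p ^ k) : ∃ Λ, IsSpectralFor B T Λ := by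
  classical
  have hp : p.Prime := Fact.out
  obtain ⟨s, hs, t, ht, hst⟩ := one_lt_card.1 (show 1 < T.card by rw [hT]; exact hp.one_lt)
  set H := AddSubgroup.zmultiples (t - s) with hH
  have hord : addOrderOf (t - s) = p :=
    addOrderOf_eq_prime (hG _) (sub_ne_zero.2 hst.symm)
  have hcard : Nat.card (G ⧸ H) = B.card := by
    have h1 := AddSubgroup.card_eq_card_quotient_mul_card_addSubgroup H
    rw [hH, Nat.card_zmultiples, hord, ← hH, ← h.card_mul, hT] at h1
    exact (Nat.eq_of_mul_eq_mul_right hp.pos h1).symm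
  cases nonempty_fintype (G ⧸ H)
  have hcop : ∀ j, 0 < j → j < p → j.Coprime (Nat.card G) := fun j hj hjp => by
    rw [hk]
    exact Nat.Coprime.pow_right k (Nat.coprime_of_lt_prime hj.ne' hjp hp).symm
  refine ⟨univ.image fun χ : AddChar (G ⧸ H) ℂ => χ.compAddMonoidHom (QuotientAddGroup.mk' H),
    ?_, ?_⟩
  · rw [card_image_of_injective, card_univ, AddChar.card_eq, ← hcard, Nat.card_eq_fintype_card]
    exact AddChar.compAddMonoidHom_injective_left _ (QuotientAddGroup.mk'_surjective H)
  · intro χ' hχ' ψ' hψ' _ h0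
    obtain ⟨χ, -, rfl⟩ := mem_image.1 hχ'
    obtain ⟨ψ, -, rfl⟩ := mem_image.1 hψ'
    rw [← AddChar.sub_compAddMonoidHom] at h0
    set θ := (χ - ψ).compAddMonoidHom (QuotientAddGroup.mk' H) with hθ
    have hθst : θ t = θ s := by
      simp only [hθ, AddChar.compAddMonoidHom_apply, QuotientAddGroup.mk'_apply]
      congr 1
      rw [QuotientAddGroup.eq, neg_add_eq_sub, ← neg_sub]
      exact H.neg_mem (AddSubgroup.mem_zmultiples _)
    have h1 : ∑ j ∈ range p, (θ s ^ j)⁻¹ * charSum T (j • θ) = p := by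
      rw [Finset.sum_eq_single 0]
      · simp [hT]
      · intro j hj hj0
        rw [charSum_nsmul_eq_zero (hcop j (Nat.pos_of_ne_zero hj0) (mem_range.1 hj)) h0, mul_zero]
      · intro h; exact (h (mem_range.2 hp.pos)).elim
    have h2 : ∑ j ∈ range p, (θ s ^ j)⁻¹ * charSum T (j • θ) =
        ∑ u ∈ T, if θ u = θ s then (p : ℂ) else 0 := by
      simp_rw [charSum, Finset.mul_sum]
      rw [Finset.sum_comm]
      refine Finset.sum_congr rfl fun u _ => ?_
      have : ∀ j, (θ s ^ j)⁻¹ * (j • θ) u = θ (u - s) ^ j := fun j => by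
        rw [AddChar.nsmul_apply, AddChar.map_sub_eq_div, div_pow]; ring
      simp_rw [this]
      split_ifs with hu
      · rw [AddChar.map_sub_eq_div, hu, div_self (θ.apply_ne_zero s)]; simp
      · have hne : θ (u - s) ≠ 1 := fun e => hu (by
          rwa [AddChar.map_sub_eq_div, div_eq_one_iff_eq (θ.apply_ne_zero s)] at e)
        rw [geom_sum_eq hne, ← AddChar.map_nsmul_eq_pow, hG]
        simp
    rw [h1, ← Finset.sum_filter, Finset.sum_const, nsmul_eq_mul] at h2
    have hp0 : (p : ℂ) ≠ 0 := by exact_mod_cast hp.ne_zero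
    have h3 : (T.filter fun u => θ u = θ s).card = 1 := by
      have : ((T.filter fun u => θ u = θ s).card : ℂ) = 1 := by
        apply mul_right_cancel₀ hp0
        rw [one_mul, ← h2]
      exact_mod_cast this
    exact hst (card_le_one.1 h3.le s (mem_filter.2 ⟨hs, rfl⟩) t (mem_filter.2 ⟨ht, hθst⟩))

/-- The multiples of one nonzero χ of T^ work, since all nontrivial ones are conjugate to χ. -/
lemma exists_isSpectralFor_of_card_eq_prime' (hG : ∀ g : G, p • g = 0) {B T : Finset G}
    (h : IsTilingPair B T) (hB : B.card = p) {k : ℕ} (hk : Nat.card G = p ^ k) :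
    ∃ Λ, IsSpectralFor B T Λ := by
  classical
  have hp : p.Prime := Fact.out
  obtain ⟨χ, hχ, hT⟩ := exists_charSum_ne_zero h (by rw [hB]; exact hp.one_lt)
  have hpχ : p • χ = 0 := by
    ext g
    rw [AddChar.nsmul_apply, ← AddChar.map_nsmul_eq_pow, hG]
    simp
  have hord : addOrderOf χ = p := addOrderOf_eq_prime hpχ hχ
  have key : ∀ a b, a < b → b < p → charSum T (b • χ - a • χ) ≠ 0 := by
    intro a b hab hbp h0
    have e : b • χ - a • χ = (b - a) • χ := by
      rw [sub_eq_iff_eq_add, ← add_nsmul, Nat.sub_add_cancel hab.le]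
    rw [e] at h0
    have hco : (b - a).Coprime p :=
      (Nat.coprime_of_lt_prime (by omega) (by omega) hp).symm
    obtain ⟨m, hm⟩ : ∃ m, m * (b - a) ≡ 1 [MOD p] := by
      obtain ⟨m, hm⟩ := Nat.exists_mul_mod_eq_one_of_coprime hco hp.one_lt
      exact ⟨m, by rw [mul_comm, Nat.ModEq, hm.2, Nat.mod_eq_of_lt hp.one_lt]⟩
    have hmco : m.Coprime (Nat.card G) := by
      rw [hk]
      refine Nat.Coprime.pow_right k ?_
      have : (m * (b - a)).Coprime p := hm.gcd_eq.trans (Nat.gcd_one_left p)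
      exact Nat.Coprime.coprime_mul_right this
    have h1 := charSum_nsmul_eq_zero hmco h0
    have e' : (m * (b - a)) • χ = 1 • χ := nsmul_eq_nsmul_iff_modEq.2 (by rwa [hord])
    rw [smul_smul, e', one_nsmul] at h1
    exact hT h1
  refine ⟨(range p).image (· • χ), ?_, ?_⟩
  · rw [card_image_of_injOn, card_range, hB]
    intro a ha b hb e
    have := nsmul_eq_nsmul_iff_modEq.1 e
    rw [hord] at this
    exact this.eq_of_lt_of_lt (mem_range.1 ha) (mem_range.1 hb)
  · intro χ' hχ' ψ' hψ' hne
    obtain ⟨a, ha, rfl⟩ := mem_image.1 hχ'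
    obtain ⟨b, hb, rfl⟩ := mem_image.1 hψ'
    rcases lt_trichotomy a b with hab | rfl | hab
    · rw [Ne, charSum_sub_comm]
      exact key a b hab (mem_range.1 hb)
    · exact (hne rfl).elim
    · exact key b a hab (mem_range.1 ha)

lemma hasUniversalSpectra_prime_pow_three : HasUniversalSpectra (Fin 3 → ZMod p) := by
  have hp : p.Prime := Fact.out
  refine hasUniversalSpectra_of_forall fun B T h => ?_
  have hG : ∀ g : Fin 3 → ZMod p, p • g = 0 := fun g => by ext; simp
  have hk : Nat.card (Fin 3 → ZMod p) = p ^ 3 := by simp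
  have hc := h.card_mul
  rw [hk] at hc
  obtain ⟨j, hj, hTj⟩ := (Nat.dvd_prime_pow hp).1 ⟨B.card, by rw [mul_comm, hc]⟩
  have hB : B.card = p ^ (3 - j) := by
    rw [hTj, show p ^ 3 = p ^ (3 - j) * p ^ j by rw [← pow_add, Nat.sub_add_cancel hj]] at hc
    exact Nat.eq_of_mul_eq_mul_right (pow_pos hp.pos j) hc
  interval_cases j
  · exact exists_isSpectralFor_of_card_eq_one h (by simpa using hTj)
  · exact exists_isSpectralFor_of_card_eq_prime hG h (by simpa using hTj) hk
  · exact exists_isSpectralFor_of_card_eq_prime' hG h (by simpa using hB) hk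
  · exact exists_isSpectralFor_of_card_eq_one' (by simpa using hB)

end ElementaryAbelian

/-! ### Adding one digit to a digit set -/

section DigitSets

/-- Adjoining the multiples of `g` to a set whose differences are good. -/
lemma exists_extend_good {A : Type*} [AddCommGroup A] {p : ℕ} [Fact p.Prime] {Good : A → Prop}
    (h0 : ¬ Good 0) {Λ : Finset A} (hΛ : ∀ x ∈ Λ, ∀ y ∈ Λ, x ≠ y → Good (x - y)) {g : A}
    (hg : ∀ a : ℤ, IsCoprime a p → ∀ x ∈ Λ, ∀ y ∈ Λ, Good (a • g + (x - y))) :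
    ∃ Λ' : Finset A, Λ'.card = p * Λ.card ∧ (∀ x ∈ Λ', ∀ y ∈ Λ', x ≠ y → Good (x - y)) ∧
      ∀ x ∈ Λ', ∃ a : ℤ, ∃ y ∈ Λ, x = a • g + y := by
  classical
  have hp : p.Prime := Fact.out
  have key : ∀ a ∈ range p, ∀ b ∈ range p, ∀ x ∈ Λ, ∀ y ∈ Λ, a ≠ b →
      Good (((a : ℤ) • g + x) - ((b : ℤ) • g + y)) := by
    intro a ha b hb x hx y hy hab
    have e : ((a : ℤ) • g + x) - ((b : ℤ) • g + y) = ((a : ℤ) - b) • g + (x - y) := by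
      rw [sub_smul]; abel
    rw [e]
    refine hg _ ?_ x hx y hy
    refine ((Nat.prime_iff_prime_int.1 hp).coprime_iff_not_dvd.2 fun hd => hab ?_).symm
    rw [mem_range] at ha hb
    have := Int.eq_zero_of_abs_lt_dvd hd (by rw [abs_lt]; omega)
    omega
  refine ⟨(range p ×ˢ Λ).image fun z => (z.1 : ℤ) • g + z.2, ?_, ?_, ?_⟩
  · rw [card_image_of_injOn, card_product, card_range]
    rintro ⟨a, x⟩ h1 ⟨b, y⟩ h2 e
    simp only [coe_product, Set.mem_prod, mem_coe] at h1 h2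
    by_cases hab : a = b
    · subst hab
      exact Prod.ext rfl (add_left_cancel e)
    · have := key a h1.1 b h2.1 x h1.2 y h2.2 hab
      simp only at e
      rw [e, sub_self] at this
      exact (h0 this).elim
  · intro x' hx' y' hy' hne
    obtain ⟨⟨a, x⟩, h1, rfl⟩ := mem_image.1 hx'
    obtain ⟨⟨b, y⟩, h2, rfl⟩ := mem_image.1 hy'
    rw [mem_product] at h1 h2
    by_cases hab : a = b
    · subst hab
      have hxy : x ≠ y := fun e => hne (by simp only [e])
      simpa using hΛ x h1.2 y h2.2 hxy
    · exact key a h1.1 b h2.1 x h1.2 y h2.2 hab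
  · intro x' hx'
    obtain ⟨⟨a, x⟩, h1, rfl⟩ := mem_image.1 hx'
    exact ⟨a, x, (mem_product.1 h1).2, rfl⟩

end DigitSets

/-! ### The filtration of `ZMod (p ^ n)` by order -/

section Levels

variable {p n : ℕ}

/-- The elements of `ZMod (p ^ n)` of order dividing `p ^ j`, parametrised by integers. -/
def lev (p n j : ℕ) (w : ℤ) : ZMod (p ^ n) := (p : ZMod (p ^ n)) ^ (n - j) * (w : ZMod (p ^ n))

lemma lev_add (j : ℕ) (w w' : ℤ) : lev p n j (w + w') = lev p n j w + lev p n j w' := by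
  simp [lev, mul_add]

lemma lev_sub (j : ℕ) (w w' : ℤ) : lev p n j (w - w') = lev p n j w - lev p n j w' := by
  simp [lev, mul_sub]

lemma zsmul_lev (j : ℕ) (m w : ℤ) : m • lev p n j w = lev p n j (m * w) := by
  simp only [lev, zsmul_eq_mul]; push_cast; ring

lemma lev_pow_mul {i j : ℕ} (hij : i ≤ j) (hj : j ≤ n) (w : ℤ) :
    lev p n j ((p : ℤ) ^ (j - i) * w) = lev p n i w := by
  simp only [lev]
  push_cast
  rw [← mul_assoc, ← pow_add]
  congr 2
  omega

lemma lev_succ_mul {j : ℕ} (hj : j + 1 ≤ n) (w : ℤ) :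
    lev p n (j + 1) ((p : ℤ) * w) = lev p n j w := by
  simpa using lev_pow_mul (p := p) (Nat.le_succ j) hj w

lemma prime_pow_self_eq_zero : (p : ZMod (p ^ n)) ^ n = 0 := by
  rw [← Nat.cast_pow, ZMod.natCast_self]

lemma lev_mul_eq_zero {j : ℕ} (hj : j ≤ n) (w : ℤ) {z : ZMod (p ^ n)}
    (hz : (p : ZMod (p ^ n)) ^ j ∣ z) : lev p n j w * z = 0 := by
  obtain ⟨c, rfl⟩ := hz
  have : lev p n j w * ((p : ZMod (p ^ n)) ^ j * c) =
      ((p : ZMod (p ^ n)) ^ (n - j) * (p : ZMod (p ^ n)) ^ j) * (w * c) := by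
    rw [lev]; ring
  rw [this, ← pow_add, Nat.sub_add_cancel hj, prime_pow_self_eq_zero, zero_mul]

lemma lev_zero (w : ℤ) : lev p n 0 w = 0 := by
  simp [lev, prime_pow_self_eq_zero]

lemma isCoprime_pow_card {m : ℤ} (hm : IsCoprime m p) (k : ℕ) : IsCoprime m ((p ^ k : ℕ) : ℤ) := by
  push_cast; exact hm.pow_right

lemma exists_inv_mod {w : ℤ} (hw : IsCoprime w p) (n : ℕ) :
    ∃ w' : ℤ, IsCoprime w' p ∧ ((w' * w : ℤ) : ZMod (p ^ n)) = 1 := by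
  -- The exponent n + 1 makes a prime to p even for n = 0.
  obtain ⟨a, b, hab⟩ := (hw.pow_right (n := n + 1))
  refine ⟨a, ⟨w, b * p ^ n, ?_⟩, ?_⟩
  · rw [← hab]; ring
  · have : a * w = 1 - b * p * (p ^ n : ℕ) := by
      push_cast
      rw [← hab]; ring
    rw [this]
    push_cast
    rw [prime_pow_self_eq_zero]
    ring

lemma lev_congr {w w' : ℤ} (h : (w : ZMod (p ^ n)) = w') (j : ℕ) : lev p n j w = lev p n j w' := by
  rw [lev, lev, h]

variable [Fact p.Prime]

lemma lev_one_mul_eq_zero_iff {j : ℕ} (hj : j ≤ n) {z : ZMod (p ^ n)} :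
    lev p n j 1 * z = 0 ↔ (p : ZMod (p ^ n)) ^ j ∣ z := by
  refine ⟨fun h => ?_, lev_mul_eq_zero hj 1⟩
  have hp : p.Prime := Fact.out
  have hz : ((z.val : ℕ) : ZMod (p ^ n)) = z := ZMod.natCast_rightInverse z
  rw [← hz, lev, Int.cast_one, mul_one, ← Nat.cast_pow, ← Nat.cast_mul, ZMod.natCast_eq_zero_iff] at h
  have hpn : p ^ (n - j) * p ^ j = p ^ n := by rw [← pow_add, Nat.sub_add_cancel hj]
  obtain ⟨c, hc⟩ := Nat.dvd_of_mul_dvd_mul_left (pow_pos hp.pos (n - j)) (hpn.dvd.trans h)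
  rw [← hz, hc]
  exact ⟨c, by push_cast; rfl⟩

lemma lev_ne_zero {k : ℕ} (hk : 1 ≤ k) (hkn : k ≤ n) {w : ℤ} (hw : IsCoprime w p) :
    lev p n k w ≠ 0 := by
  have hp : p.Prime := Fact.out
  intro h
  have h2 : (((p : ℤ) ^ (n - k) * w : ℤ) : ZMod (p ^ n)) = 0 := by
    rw [← h, lev]; push_cast; rfl
  rw [ZMod.intCast_zmod_eq_zero_iff_dvd] at h2
  push_cast at h2
  have h3 : (p : ℤ) ^ n = (p : ℤ) ^ (n - k) * (p : ℤ) ^ k := by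
    rw [← pow_add, Nat.sub_add_cancel hkn]
  rw [h3] at h2
  have h4 := Int.dvd_of_mul_dvd_mul_left (pow_ne_zero _ (by exact_mod_cast hp.ne_zero)) h2
  have h5 : (p : ℤ) ∣ w := (dvd_pow_self _ (by omega)).trans h4
  exact (Nat.prime_iff_prime_int.1 hp).not_isUnit (hw.isUnit_of_dvd' h5 dvd_rfl)

lemma sum_range_prime_pow_stdAddChar {j : ℕ} (hj : j ≤ n) (z : ZMod (p ^ n))
    [Decidable ((p : ZMod (p ^ n)) ^ j ∣ z)] :
    ∑ w ∈ range (p ^ j), (ZMod.stdAddChar (lev p n j w * z) : ℂ) =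
      if (p : ZMod (p ^ n)) ^ j ∣ z then (p : ℂ) ^ j else 0 := by
  have h1 : ∀ w : ℕ, (ZMod.stdAddChar (lev p n j w * z) : ℂ) =
      ZMod.stdAddChar (lev p n j 1 * z) ^ w := fun w => by
    rw [← AddChar.map_nsmul_eq_pow]
    congr 1
    simp only [lev, nsmul_eq_mul]
    push_cast
    ring
  simp_rw [h1]
  split_ifs with h
  · rw [lev_mul_eq_zero hj 1 h]
    simp
  · have hne : (ZMod.stdAddChar (lev p n j 1 * z) : ℂ) ≠ 1 := fun e => h <| by
      rw [← AddChar.map_zero_eq_one (ZMod.stdAddChar (N := p ^ n))] at e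
      exact (lev_one_mul_eq_zero_iff hj).1 (ZMod.injective_stdAddChar e)
    rw [geom_sum_eq hne, ← h1]
    have : lev p n j ((p ^ j : ℕ) : ℤ) = 0 := by
      have := lev_pow_mul (p := p) (n := n) (Nat.zero_le j) hj 1
      rw [lev_zero] at this
      simpa using this
    rw [this]
    simp

end Levels

/-! ### Fibers of T over residues of the first coordinate -/

section Fibers

variable {p n : ℕ} [Fact p.Prime]

/-- The character of `ZMod (p ^ n) × ZMod p` with coordinates `x`. -/
noncomputable def pairChar (p n : ℕ) [Fact p.Prime] :
    ZMod (p ^ n) × ZMod p →+ AddChar (ZMod (p ^ n) × ZMod p) ℂ :=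
  AddMonoidHom.mk' (fun x =>
    (ZMod.stdAddChar.mulShift x.1).compAddMonoidHom (AddMonoidHom.fst (ZMod (p ^ n)) (ZMod p)) +
      (ZMod.stdAddChar.mulShift x.2).compAddMonoidHom (AddMonoidHom.snd (ZMod (p ^ n)) (ZMod p)))
    (fun x y => by
      ext t
      simp only [Prod.fst_add, Prod.snd_add, AddChar.add_apply, AddChar.compAddMonoidHom_apply,
        AddChar.mulShift_apply, add_mul, AddChar.map_add_eq_mul]
      ring)

lemma pairChar_apply (x t : ZMod (p ^ n) × ZMod p) :
    pairChar p n x t = ZMod.stdAddChar (x.1 * t.1) * ZMod.stdAddChar (x.2 * t.2) := rfl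

lemma pairChar_injective : Function.Injective (pairChar p n) := by
  rw [injective_iff_map_eq_zero]
  intro x hx
  refine Prod.ext ?_ ?_
  · have := DFunLike.congr_fun hx (1, 0)
    simp only [pairChar_apply, mul_one, mul_zero, AddChar.map_zero_eq_one, AddChar.zero_apply] at this
    exact ZMod.injective_stdAddChar (this.trans (AddChar.map_zero_eq_one _).symm)
  · have := DFunLike.congr_fun hx (0, 1)
    simp only [pairChar_apply, mul_one, mul_zero, AddChar.map_zero_eq_one, AddChar.zero_apply,
      one_mul] at this
    exact ZMod.injective_stdAddChar (this.trans (AddChar.map_zero_eq_one _).symm)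

lemma charSum_pairChar_zsmul {T : Finset (ZMod (p ^ n) × ZMod p)} {x : ZMod (p ^ n) × ZMod p}
    {m : ℤ} (hm : IsCoprime m p) (h : charSum T (pairChar p n x) = 0) :
    charSum T (pairChar p n (m • x)) = 0 := by
  rw [map_zsmul]
  refine charSum_zsmul_eq_zero ?_ h
  have : Nat.card (ZMod (p ^ n) × ZMod p) = p ^ (n + 1) := by simp [pow_succ]
  rw [this]
  exact isCoprime_pow_card hm _

open Classical in
/-- The elements of `T` whose first coordinate is congruent to `z` modulo `p ^ j`. -/
noncomputable def fib (T : Finset (ZMod (p ^ n) × ZMod p)) (j : ℕ) (z : ZMod (p ^ n)) :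
    Finset (ZMod (p ^ n) × ZMod p) :=
  T.filter fun t => (p : ZMod (p ^ n)) ^ j ∣ t.1 - z

lemma mem_fib {T : Finset (ZMod (p ^ n) × ZMod p)} {j : ℕ} {z : ZMod (p ^ n)}
    {t : ZMod (p ^ n) × ZMod p} : t ∈ fib T j z ↔ t ∈ T ∧ (p : ZMod (p ^ n)) ^ j ∣ t.1 - z := by
  classical
  simp [fib]

lemma fib_zero (T : Finset (ZMod (p ^ n) × ZMod p)) (z : ZMod (p ^ n)) : fib T 0 z = T := by
  ext t; simp [mem_fib]

lemma fib_succ_subset (T : Finset (ZMod (p ^ n) × ZMod p)) (j : ℕ) (z : ZMod (p ^ n)) :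
    fib T (j + 1) z ⊆ fib T j z := fun _ h =>
  mem_fib.2 ⟨(mem_fib.1 h).1, (pow_dvd_pow _ (Nat.le_succ j)).trans (mem_fib.1 h).2⟩

/-- Fourier inversion along the reduction modulo `p ^ j`. -/
lemma pow_mul_sum_fib (T : Finset (ZMod (p ^ n) × ZMod p)) {j : ℕ} (hj : j ≤ n)
    (f : ZMod (p ^ n) × ZMod p → ℂ) (z : ZMod (p ^ n)) :
    ∑ w ∈ range (p ^ j), ZMod.stdAddChar (-(lev p n j w * z)) *
      ∑ t ∈ T, f t * ZMod.stdAddChar (lev p n j w * t.1) = (p : ℂ) ^ j * ∑ t ∈ fib T j z, f t := by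
  classical
  simp_rw [Finset.mul_sum]
  rw [Finset.sum_comm, fib, Finset.sum_filter]
  refine Finset.sum_congr rfl fun t _ => ?_
  have : ∀ w : ℕ, ZMod.stdAddChar (-(lev p n j w * z)) *
      (f t * ZMod.stdAddChar (lev p n j w * t.1)) =
      f t * (ZMod.stdAddChar (lev p n j w * (t.1 - z)) : ℂ) := fun w => by
    rw [mul_sub, sub_eq_neg_add, AddChar.map_add_eq_mul]; ring
  simp_rw [this]
  rw [← Finset.mul_sum, sum_range_prime_pow_stdAddChar hj]
  split_ifs <;> ring

lemma sum_fib_eq_zero {T : Finset (ZMod (p ^ n) × ZMod p)} {j : ℕ} (hj : j ≤ n)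
    {f : ZMod (p ^ n) × ZMod p → ℂ}
    (h : ∀ w : ℤ, ∑ t ∈ T, f t * ZMod.stdAddChar (lev p n j w * t.1) = 0) (z : ZMod (p ^ n)) :
    ∑ t ∈ fib T j z, f t = 0 := by
  have h1 := pow_mul_sum_fib T hj f z
  simp only [h, mul_zero, Finset.sum_const_zero] at h1
  have hp : p.Prime := Fact.out
  exact (mul_eq_zero.1 h1.symm).resolve_left (pow_ne_zero _ (by exact_mod_cast hp.ne_zero))

lemma sum_eq_zero_of_sum_fib {T : Finset (ZMod (p ^ n) × ZMod p)} {j : ℕ}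
    {f g : ZMod (p ^ n) × ZMod p → ℂ} (h : ∀ z, ∑ t ∈ fib T j z, f t = 0)
    (hg : ∀ t ∈ T, ∀ t' ∈ T, (p : ZMod (p ^ n)) ^ j ∣ t.1 - t'.1 → g t = g t') :
    ∑ t ∈ T, g t * f t = 0 := by
  classical
  let R : Setoid (ZMod (p ^ n) × ZMod p) :=
    { r := fun a b => (p : ZMod (p ^ n)) ^ j ∣ a.1 - b.1
      iseqv := ⟨fun a => by simp, fun {a b} h => (dvd_sub_comm).1 h, fun {a b c} h h' => by
        simpa using dvd_add h h'⟩ }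
  refine Finset.sum_cancels_of_partition_cancels R fun x hx => ?_
  have : ∑ a ∈ T with R a x, g a * f a = g x * ∑ a ∈ fib T j x.1, f a := by
    have hfil : T.filter (fun a => R a x) = fib T j x.1 := by
      ext a
      rw [mem_filter, mem_fib]
      rfl
    rw [Finset.mul_sum, hfil]
    refine Finset.sum_congr rfl fun a ha => ?_
    obtain ⟨ha, ha'⟩ := mem_fib.1 ha
    rw [hg a ha x hx ha']
  rw [this, h, mul_zero]

lemma sum_range_mul_eq {p m : ℕ} (hp : 0 < p) {F : ℕ → ℂ} (hF : ∀ w, ¬ p ∣ w → F w = 0) :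
    ∑ w ∈ range (p * m), F w = ∑ w ∈ range m, F (p * w) := by
  have hinj : Function.Injective (p * ·) := fun a b e => Nat.eq_of_mul_eq_mul_left hp e
  rw [← Finset.sum_image (f := F) (g := (p * ·)) hinj.injOn]
  symm
  refine Finset.sum_subset ?_ ?_
  · intro x hx
    obtain ⟨w, hw, rfl⟩ := mem_image.1 hx
    exact mem_range.2 (Nat.mul_lt_mul_of_pos_left (mem_range.1 hw) hp)
  · intro x hx hx'
    refine hF x fun ⟨w, hw⟩ => hx' ?_
    subst hw
    exact mem_image.2 ⟨w, mem_range.2 (lt_of_mul_lt_mul_left (mem_range.1 hx) (Nat.zero_le _)), rfl⟩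

lemma isCoprime_of_not_dvd {w : ℤ} (h : ¬ (p : ℤ) ∣ w) : IsCoprime w p :=
  ((Nat.prime_iff_prime_int.1 Fact.out).coprime_iff_not_dvd.2 h).symm

/-- In the inversion formula modulo p ^ (j + 1), the frequencies prime to p are conjugates of the
given zero. The others are those of level j, so the formula collapses to the one modulo p ^ j. -/
lemma mul_card_fib_succ {T : Finset (ZMod (p ^ n) × ZMod p)} {j : ℕ} (hj : j + 1 ≤ n)
    (h : charSum T (pairChar p n (lev p n (j + 1) 1, 0)) = 0) (z : ZMod (p ^ n)) :
    p * (fib T (j + 1) z).card = (fib T j z).card := by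
  have hp : p.Prime := Fact.out
  have hS : ∀ (k : ℕ) (w : ℤ), charSum T (pairChar p n (lev p n k w, 0)) =
      ∑ t ∈ T, 1 * ZMod.stdAddChar (lev p n k w * t.1) := fun k w => by
    simp [charSum, pairChar_apply]
  have h1 := pow_mul_sum_fib T hj (fun _ => 1) z
  have h2 := pow_mul_sum_fib T (Nat.le_of_succ_le hj) (fun _ => 1) z
  simp only [← hS] at h1 h2
  rw [pow_succ', sum_range_mul_eq hp.pos] at h1
  · have h3 : ∀ w : ℕ, lev p n (j + 1) ((p * w : ℕ) : ℤ) = lev p n j w := fun w => by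
      rw [← lev_succ_mul hj]; push_cast; rfl
    simp only [h3] at h1
    rw [h2, Finset.sum_const, Finset.sum_const, nsmul_eq_mul, nsmul_eq_mul, mul_one, mul_one] at h1
    have hp0 : ((p : ℂ) ^ j) ≠ 0 := pow_ne_zero _ (by exact_mod_cast hp.ne_zero)
    have h4 : ((p * (fib T (j + 1) z).card : ℕ) : ℂ) = (fib T j z).card := by
      apply mul_left_cancel₀ hp0
      rw [h1]; push_cast; ring
    exact_mod_cast h4
  · intro w hw
    have hw' : IsCoprime (w : ℤ) p := isCoprime_of_not_dvd (by exact_mod_cast hw)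
    have := charSum_pairChar_zsmul hw' h
    rw [Prod.smul_mk, zsmul_lev, mul_one, smul_zero] at this
    rw [this, mul_zero]

variable {T : Finset (ZMod (p ^ n) × ZMod p)} {J : Finset ℕ}

lemma filter_lt_eq_of_notMem {j : ℕ} (h : j + 1 ∉ J) :
    J.filter (j < ·) = J.filter (j + 1 < ·) := by
  ext k
  simp only [mem_filter, and_congr_right_iff]
  intro hk
  have : k ≠ j + 1 := fun e => h (e ▸ hk)
  omega

lemma card_filter_lt_of_mem {j : ℕ} (h : j + 1 ∈ J) :
    (J.filter (j < ·)).card = (J.filter (j + 1 < ·)).card + 1 := by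
  have : J.filter (j < ·) = insert (j + 1) (J.filter (j + 1 < ·)) := by
    ext k
    simp only [mem_filter, mem_insert]
    constructor
    · rintro ⟨h1, h2⟩
      by_cases e : k = j + 1
      · exact Or.inl e
      · exact Or.inr ⟨h1, by omega⟩
    · rintro (rfl | ⟨h1, h2⟩)
      · exact ⟨h, by omega⟩
      · exact ⟨h1, by omega⟩
  rw [this, card_insert_of_notMem (by simp)]

/-- Descending in j, each level of `J` splits fibers evenly into p parts and gains a factor p; at
other levels a fiber is a disjoint union of smaller ones. -/
lemma pow_card_dvd_card_fib
    (hJ : ∀ k ∈ J, k ≤ n → charSum T (pairChar p n (lev p n k 1, 0)) = 0) (hJn : ∀ k ∈ J, k ≤ n)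
    {j : ℕ} (hj : j ≤ n) : ∀ z, p ^ (J.filter (j < ·)).card ∣ (fib T j z).card := by
  classical
  induction hj using Nat.decreasingInduction with
  | self =>
    intro z
    have : J.filter (n < ·) = ∅ := by
      rw [filter_eq_empty_iff]
      intro k hk
      have := hJn k hk
      omega
    simp [this]
  | of_succ j hj ih =>
    intro z
    by_cases hjJ : j + 1 ∈ J
    · rw [card_filter_lt_of_mem hjJ, pow_succ', ← mul_card_fib_succ hj (hJ _ hjJ hj) z]
      exact Nat.mul_dvd_mul_left _ (ih z)
    · rw [filter_lt_eq_of_notMem hjJ, card_eq_sum_card_image (fun t => fib T (j + 1) t.1) (fib T j z)]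
      refine Finset.dvd_sum fun b hb => ?_
      obtain ⟨t₀, ht₀, rfl⟩ := mem_image.1 hb
      have : (fib T j z).filter (fun t => fib T (j + 1) t.1 = fib T (j + 1) t₀.1) =
          fib T (j + 1) t₀.1 := by
        ext t
        rw [mem_filter]
        constructor
        · rintro ⟨h1, h2⟩
          rw [← h2, mem_fib]
          exact ⟨(mem_fib.1 h1).1, by simp⟩
        · intro h
          have h' := (mem_fib.1 h).2
          refine ⟨mem_fib.2 ⟨(mem_fib.1 h).1, ?_⟩, ?_⟩
          · have h2 := (pow_dvd_pow (p : ZMod (p ^ n)) (Nat.le_succ j)).trans h'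
            simpa using dvd_add h2 (mem_fib.1 ht₀).2
          · ext s
            rw [mem_fib, mem_fib, and_congr_right_iff]
            intro _
            refine ⟨fun h3 => ?_, fun h3 => ?_⟩
            · simpa using dvd_add h3 h'
            · simpa using dvd_sub h3 h'
      rw [this]
      exact ih _

lemma card_fib_le (hJ : ∀ k ∈ J, k ≤ n → charSum T (pairChar p n (lev p n k 1, 0)) = 0)
    (hJ1 : ∀ k ∈ J, 1 ≤ k) (hT : T.card = p ^ J.card) {j : ℕ} (hj : j ≤ n) (z : ZMod (p ^ n)) :
    (fib T j z).card ≤ p ^ (J.filter (j < ·)).card := by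
  have hp : p.Prime := Fact.out
  induction j with
  | zero =>
    have : J.filter (0 < ·) = J := filter_true_of_mem fun k hk => hJ1 k hk
    rw [this, fib_zero, hT]
  | succ j ih =>
    have h1 := ih (by omega)
    by_cases hjJ : j + 1 ∈ J
    · rw [card_filter_lt_of_mem hjJ, pow_succ', ← mul_card_fib_succ hj (hJ _ hjJ hj) z] at h1
      exact Nat.le_of_mul_le_mul_left h1 hp.pos
    · rw [← filter_lt_eq_of_notMem hjJ]
      exact (card_le_card (fib_succ_subset T j z)).trans h1

/-- A nonempty fiber at level j + 1 already has at least as many points as a fiber at level j may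
have, so there is no room for a second one. -/
lemma pow_dvd_sub_of_notMem (hJ : ∀ k ∈ J, k ≤ n → charSum T (pairChar p n (lev p n k 1, 0)) = 0)
    (hJ1 : ∀ k ∈ J, 1 ≤ k) (hJn : ∀ k ∈ J, k ≤ n) (hT : T.card = p ^ J.card) {j : ℕ}
    (hj : j + 1 ≤ n) (hjJ : j + 1 ∉ J) {t t' : ZMod (p ^ n) × ZMod p} (ht : t ∈ T) (ht' : t' ∈ T)
    (h : (p : ZMod (p ^ n)) ^ j ∣ t.1 - t'.1) : (p : ZMod (p ^ n)) ^ (j + 1) ∣ t.1 - t'.1 := by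
  classical
  have hp : p.Prime := Fact.out
  by_contra hc
  have hpos : ∀ s ∈ T, p ^ (J.filter (j + 1 < ·)).card ≤ (fib T (j + 1) s.1).card := fun s hs =>
    Nat.le_of_dvd (card_pos.2 ⟨s, mem_fib.2 ⟨hs, by simp⟩⟩) (pow_card_dvd_card_fib hJ hJn hj s.1)
  have hdisj : Disjoint (fib T (j + 1) t.1) (fib T (j + 1) t'.1) := by
    rw [disjoint_left]
    intro s h1 h2
    apply hc
    simpa using dvd_sub (mem_fib.1 h2).2 (mem_fib.1 h1).2
  have hsub : fib T (j + 1) t.1 ∪ fib T (j + 1) t'.1 ⊆ fib T j t'.1 := by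
    refine union_subset (fun s hs => ?_) (fib_succ_subset T j _)
    refine mem_fib.2 ⟨(mem_fib.1 hs).1, ?_⟩
    have h1 := (pow_dvd_pow (p : ZMod (p ^ n)) (Nat.le_succ j)).trans (mem_fib.1 hs).2
    simpa using dvd_add h1 h
  have h1 := card_le_card hsub
  rw [card_union_of_disjoint hdisj] at h1
  have h2 := card_fib_le hJ hJ1 hT (show j ≤ n by omega) t'.1
  rw [filter_lt_eq_of_notMem hjJ] at h2
  have h3 := hpos t ht
  have h4 := hpos t' ht'
  have h5 : 0 < p ^ (J.filter (j + 1 < ·)).card := pow_pos hp.pos _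
  omega

end Fibers

/-! ### Propagation of zeros off the first axis -/

section CyclicTimesPrime

variable {p n : ℕ} [Fact p.Prime] {T : Finset (ZMod (p ^ n) × ZMod p)} {J : Finset ℕ}

/-- The transform of `T` vanishes at all `(u, v)` with `v ≠ 0` and `u` of order dividing `p ^ j`. -/
def VanishesUpTo (T : Finset (ZMod (p ^ n) × ZMod p)) (j : ℕ) : Prop :=
  ∀ (w : ℤ) (v : ZMod p), v ≠ 0 → charSum T (pairChar p n (lev p n j w, v)) = 0

lemma VanishesUpTo.mono {i j : ℕ} (h : VanishesUpTo T j) (hij : i ≤ j) (hj : j ≤ n) :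
    VanishesUpTo T i := fun w v hv => by
  rw [← lev_pow_mul hij hj]
  exact h _ v hv

lemma charSum_pairChar_eq (T : Finset (ZMod (p ^ n) × ZMod p)) (u : ZMod (p ^ n)) (v : ZMod p) :
    charSum T (pairChar p n (u, v)) =
      ∑ t ∈ T, (ZMod.stdAddChar (v * t.2) : ℂ) * ZMod.stdAddChar (u * t.1) := by
  simp [charSum, pairChar_apply, mul_comm]

lemma VanishesUpTo.sum_fib {j : ℕ} (h : VanishesUpTo T j) (hj : j ≤ n) (z : ZMod (p ^ n))
    {v : ZMod p} (hv : v ≠ 0) : ∑ t ∈ fib T j z, (ZMod.stdAddChar (v * t.2) : ℂ) = 0 :=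
  sum_fib_eq_zero (f := fun t => (ZMod.stdAddChar (v * t.2) : ℂ)) hj (fun w => by
    rw [← charSum_pairChar_eq]; exact h w v hv) z

/-- By `hsc`, characters of level j + 1 in the first coordinate are constant on fibers of level j,
so they factor out of the fiber sums. -/
lemma vanishesUpTo_succ_of_sum_fib {j : ℕ} (hj : j + 1 ≤ n)
    (hsc : ∀ t ∈ T, ∀ t' ∈ T, (p : ZMod (p ^ n)) ^ j ∣ t.1 - t'.1 →
      (p : ZMod (p ^ n)) ^ (j + 1) ∣ t.1 - t'.1)
    (h : ∀ z, ∀ v : ZMod p, v ≠ 0 → ∑ t ∈ fib T j z, (ZMod.stdAddChar (v * t.2) : ℂ) = 0) :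
    VanishesUpTo T (j + 1) := by
  intro w v hv
  have := sum_eq_zero_of_sum_fib (T := T) (j := j) (f := fun t => (ZMod.stdAddChar (v * t.2) : ℂ))
    (g := fun t => (ZMod.stdAddChar (lev p n (j + 1) w * t.1) : ℂ)) (fun z => h z v hv) ?_
  · rw [charSum_pairChar_eq, ← this]
    exact Finset.sum_congr rfl fun t _ => mul_comm _ _
  · intro t ht t' ht' htt'
    have h0 := lev_mul_eq_zero hj w (hsc t ht t' ht' htt')
    rw [mul_sub, sub_eq_zero] at h0
    simp only [h0]

lemma exists_zsmul_eq_of_ne_zero {v v' : ZMod p} (hv : v ≠ 0) (hv' : v' ≠ 0) :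
    ∃ m : ℤ, IsCoprime m p ∧ m • v = v' := by
  have h1 : (((v' / v).val : ℤ) : ZMod p) = v' / v := by
    rw [Int.cast_natCast]; exact ZMod.natCast_rightInverse _
  refine ⟨((v' / v).val : ℤ), isCoprime_of_not_dvd fun hd => ?_, ?_⟩
  · rw [← ZMod.intCast_zmod_eq_zero_iff_dvd, h1] at hd
    exact div_ne_zero hv' hv hd
  · rw [zsmul_eq_mul, h1, div_mul_cancel₀ _ hv]

lemma charSum_pairChar_zero_eq_zero {v v' : ZMod p} (hv : v ≠ 0) (hv' : v' ≠ 0)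
    (h : charSum T (pairChar p n (0, v)) = 0) : charSum T (pairChar p n (0, v')) = 0 := by
  obtain ⟨m, hm, rfl⟩ := exists_zsmul_eq_of_ne_zero hv hv'
  have := charSum_pairChar_zsmul hm h
  rwa [Prod.smul_mk, smul_zero] at this

/-- The Galois orbit of a single zero is large enough to invert over fibers of level j. On a fiber
the first-coordinate character is constant by `hsc`, so the sum over the second coordinate vanishes.
-/
lemma vanishesUpTo_succ_of_charSum_eq_zero {j : ℕ} (hj : j + 1 ≤ n)
    (hsc : ∀ t ∈ T, ∀ t' ∈ T, (p : ZMod (p ^ n)) ^ j ∣ t.1 - t'.1 →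
      (p : ZMod (p ^ n)) ^ (j + 1) ∣ t.1 - t'.1) {w : ℤ} (hw : IsCoprime w p) {v : ZMod p}
    (hv : v ≠ 0) (h : charSum T (pairChar p n (lev p n (j + 1) w, v)) = 0) :
    VanishesUpTo T (j + 1) := by
  refine vanishesUpTo_succ_of_sum_fib hj hsc fun z v' hv' => ?_
  obtain ⟨w', hw', hww'⟩ := exists_inv_mod hw n
  have h1 := charSum_pairChar_zsmul hw' h
  have hv1 : w' • v ≠ 0 := by
    rw [zsmul_eq_mul]
    refine mul_ne_zero (fun h0 => ?_) hv
    rw [ZMod.intCast_zmod_eq_zero_iff_dvd] at h0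
    exact (Nat.prime_iff_prime_int.1 Fact.out).not_isUnit (hw'.isUnit_of_dvd' h0 dvd_rfl)
  rw [Prod.smul_mk, zsmul_lev, lev_congr (w := w' * w) (w' := 1) (by rw [hww', Int.cast_one])] at h1
  generalize w' • v = v₁ at h1 hv1
  have h2 : ∀ l : ℤ, ∑ t ∈ T, (ZMod.stdAddChar (v₁ * t.2) : ℂ) *
      ZMod.stdAddChar (lev p n (j + 1) 1 * t.1) * ZMod.stdAddChar (lev p n j l * t.1) = 0 := by
    intro l
    -- Multiplying by 1 + p l fixes the second coordinate and moves the first by an arbitrary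
    -- element of level j.
    have hco : IsCoprime (1 + p * l : ℤ) p := ⟨1, -l, by ring⟩
    have h3 := charSum_pairChar_zsmul hco h1
    rw [Prod.smul_mk, zsmul_lev, mul_one, lev_add, lev_succ_mul hj] at h3
    have h4 : (1 + p * l : ℤ) • v₁ = v₁ := by
      rw [zsmul_eq_mul]; push_cast; simp
    rw [h4, charSum_pairChar_eq] at h3
    rw [← h3]
    refine Finset.sum_congr rfl fun t _ => ?_
    rw [add_mul, AddChar.map_add_eq_mul, mul_assoc]
  have h3 := sum_fib_eq_zero (f := fun t => (ZMod.stdAddChar (v₁ * t.2) : ℂ) *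
      ZMod.stdAddChar (lev p n (j + 1) 1 * t.1)) (Nat.le_of_succ_le hj) h2 z
  have h4 : ∑ t ∈ fib T j z, (ZMod.stdAddChar (v₁ * t.2) : ℂ) = 0 := by
    rcases (fib T j z).eq_empty_or_nonempty with he | ⟨t₀, ht₀⟩
    · rw [he, sum_empty]
    · have hconst : ∀ t ∈ fib T j z, (ZMod.stdAddChar (lev p n (j + 1) 1 * t.1) : ℂ) =
          ZMod.stdAddChar (lev p n (j + 1) 1 * t₀.1) := fun t ht => by
        have hd : (p : ZMod (p ^ n)) ^ j ∣ t.1 - t₀.1 := by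
          simpa using dvd_sub (mem_fib.1 ht).2 (mem_fib.1 ht₀).2
        have h0 := lev_mul_eq_zero hj 1 (hsc t (mem_fib.1 ht).1 t₀ (mem_fib.1 ht₀).1 hd)
        rw [mul_sub, sub_eq_zero] at h0
        rw [h0]
      rw [Finset.sum_congr rfl fun t ht => by rw [hconst t ht], ← Finset.sum_mul] at h3
      exact (mul_eq_zero.1 h3).resolve_right (AddChar.apply_ne_zero _ _)
  have h5 : ∀ v : ZMod p, charSum (fib T j z) (pairChar p n (0, v)) =
      ∑ t ∈ fib T j z, (ZMod.stdAddChar (v * t.2) : ℂ) := fun v => by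
    rw [charSum_pairChar_eq]; simp
  rw [← h5] at h4 ⊢
  exact charSum_pairChar_zero_eq_zero hv1 hv' h4

lemma not_vanishesUpTo_self (hT : T.Nonempty) (h1 : ∀ z, (fib T n z).card ≤ 1) :
    ¬ VanishesUpTo T n := by
  intro h
  obtain ⟨t, ht⟩ := hT
  have h2 := h.sum_fib le_rfl t.1 (one_ne_zero (α := ZMod p))
  have h3 : fib T n t.1 = {t} := by
    have hmem : t ∈ fib T n t.1 := mem_fib.2 ⟨ht, by simp⟩
    exact eq_singleton_iff_unique_mem.2 ⟨hmem, fun s hs => card_le_one.1 (h1 _) s hs t hmem⟩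
  rw [h3, sum_singleton] at h2
  exact AddChar.apply_ne_zero _ _ h2

/-- `x` is nonzero and the transform of `T` does not vanish there. -/
def GoodFor (T : Finset (ZMod (p ^ n) × ZMod p)) (x : ZMod (p ^ n) × ZMod p) : Prop :=
  x ≠ 0 ∧ charSum T (pairChar p n x) ≠ 0

/-- Adjoining digits at the levels of `K` in `(k₀, j]`. -/
lemma exists_extend_digits (K : Finset ℕ) (V : AddSubgroup (ZMod p)) {k₀ : ℕ}
    {Λ₀ : Finset (ZMod (p ^ n) × ZMod p)}
    (hmem : ∀ x ∈ Λ₀, (∃ w, x.1 = lev p n k₀ w) ∧ x.2 ∈ V)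
    (hgood : ∀ x ∈ Λ₀, ∀ y ∈ Λ₀, x ≠ y → GoodFor T (x - y))
    (hK : ∀ k ∈ K, k₀ < k → k ≤ n → ∀ w : ℤ, IsCoprime w p → ∀ v ∈ V,
      charSum T (pairChar p n (lev p n k w, v)) ≠ 0) {j : ℕ} (hkj : k₀ ≤ j) (hjn : j ≤ n) :
    ∃ Λ : Finset (ZMod (p ^ n) × ZMod p),
      Λ.card = p ^ (K.filter fun k => k₀ < k ∧ k ≤ j).card * Λ₀.card ∧
      (∀ x ∈ Λ, (∃ w, x.1 = lev p n j w) ∧ x.2 ∈ V) ∧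
      ∀ x ∈ Λ, ∀ y ∈ Λ, x ≠ y → GoodFor T (x - y) := by
  induction j, hkj using Nat.le_induction with
  | base =>
    have : (K.filter fun k => k₀ < k ∧ k ≤ k₀) = ∅ := by
      rw [filter_eq_empty_iff]; intro k _; omega
    exact ⟨Λ₀, by simp [this], hmem, hgood⟩
  | succ j hkj ih =>
    obtain ⟨Λ, hc, hm, hg⟩ := ih (by omega)
    by_cases hjK : j + 1 ∈ K
    · obtain ⟨Λ', hc', hg', hm'⟩ := exists_extend_good (p := p) (Good := GoodFor T)
        (fun h => h.1 rfl) hg (g := (lev p n (j + 1) 1, 0)) (by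
          intro a ha x hx y hy
          obtain ⟨⟨w, hw⟩, hxV⟩ := hm x hx
          obtain ⟨⟨w', hw'⟩, hyV⟩ := hm y hy
          -- The lower digits only change the unit a by a multiple of p, so the difference stays at
          -- level exactly j + 1.
          have e : a • (lev p n (j + 1) 1, (0 : ZMod p)) + (x - y) =
              (lev p n (j + 1) (a + p * (w - w')), x.2 - y.2) := by
            rw [lev_add, lev_succ_mul hjn, lev_sub, ← hw, ← hw']
            ext
            · simp [lev, mul_comm]
            · simp
          have hco : IsCoprime (a + p * (w - w')) (p : ℤ) := by
            simpa [mul_comm] using ha.add_mul_left_left (w - w')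
          rw [e]
          refine ⟨fun h0 => lev_ne_zero (by omega) hjn hco (Prod.ext_iff.1 h0).1, ?_⟩
          exact hK _ hjK (by omega) hjn _ hco _ (V.sub_mem hxV hyV))
      refine ⟨Λ', ?_, ?_, hg'⟩
      · have : (K.filter fun k => k₀ < k ∧ k ≤ j + 1) =
            insert (j + 1) (K.filter fun k => k₀ < k ∧ k ≤ j) := by
          ext k
          simp only [mem_filter, mem_insert]
          constructor
          · rintro ⟨h1, h2, h3⟩
            by_cases e : k = j + 1
            · exact Or.inl e
            · exact Or.inr ⟨h1, h2, by omega⟩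
          · rintro (rfl | ⟨h1, h2, h3⟩)
            · exact ⟨hjK, by omega, le_rfl⟩
            · exact ⟨h1, h2, by omega⟩
        rw [this, card_insert_of_notMem (by simp), hc', hc, pow_succ]
        ring
      · intro x' hx'
        obtain ⟨a, x, hx, rfl⟩ := hm' x' hx'
        obtain ⟨⟨w, hw⟩, hxV⟩ := hm x hx
        refine ⟨⟨a + p * w, ?_⟩, by simpa using hxV⟩
        rw [lev_add, lev_succ_mul hjn, ← hw]
        simp [lev, mul_comm]
    · refine ⟨Λ, ?_, ?_, hg⟩
      · rw [hc]
        congr 3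
        ext k
        simp only [mem_filter, and_congr_right_iff]
        intro hk h1
        have : k ≠ j + 1 := fun e => hjK (e ▸ hk)
        omega
      · intro x hx
        obtain ⟨⟨w, hw⟩, hxV⟩ := hm x hx
        exact ⟨⟨p * w, by rw [lev_succ_mul hjn, hw]⟩, hxV⟩

end CyclicTimesPrime

/-! ### Construction of the digit spectrum -/

section CyclicTimesPrimeMain

variable {p n : ℕ} [Fact p.Prime] {T : Finset (ZMod (p ^ n) × ZMod p)} {J : Finset ℕ}

lemma pow_card_dvd_card (hJ1 : ∀ k ∈ J, 1 ≤ k) (hJn : ∀ k ∈ J, k ≤ n)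
    (hJ : ∀ k ∈ J, charSum T (pairChar p n (lev p n k 1, 0)) = 0) : p ^ J.card ∣ T.card := by
  have := pow_card_dvd_card_fib (T := T) (fun k hk _ => hJ k hk) hJn (Nat.zero_le n) 0
  have h0 : J.filter (0 < ·) = J := filter_true_of_mem fun k hk => hJ1 k hk
  rwa [fib_zero, h0] at this

lemma charSum_lev_eq_zero {k : ℕ} {w : ℤ} (hw : IsCoprime w p)
    (h : charSum T (pairChar p n (lev p n k w, 0)) = 0) :
    charSum T (pairChar p n (lev p n k 1, 0)) = 0 := by
  obtain ⟨w', hw', hww'⟩ := exists_inv_mod hw n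
  have := charSum_pairChar_zsmul hw' h
  rwa [Prod.smul_mk, zsmul_lev, smul_zero,
    lev_congr (w := w' * w) (w' := 1) (by rw [hww', Int.cast_one])] at this

lemma exists_generator {k : ℕ} (h : ¬ VanishesUpTo T (k + 1)) (h' : VanishesUpTo T k)
    (hk : k + 1 ≤ n) : ∃ (w : ℤ) (v : ZMod p), IsCoprime w p ∧
      charSum T (pairChar p n (lev p n (k + 1) w, v)) ≠ 0 := by
  simp only [VanishesUpTo, not_forall] at h
  obtain ⟨w, v, hv, hne⟩ := h
  refine ⟨w, v, isCoprime_of_not_dvd ?_, hne⟩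
  rintro ⟨w₁, rfl⟩
  rw [lev_succ_mul hk] at hne
  exact hne (h' _ v hv)

/-- The differences `a • (u, v) + (u', 0)`, with `u'` at a lower level than `u`, are Galois
conjugate to `(u, v)`. -/
lemma goodFor_generator {k : ℕ} (hk : k + 1 ≤ n) {w : ℤ} {v : ZMod p} (hw : IsCoprime w p)
    (hne : charSum T (pairChar p n (lev p n (k + 1) w, v)) ≠ 0) {a : ℤ} (ha : IsCoprime a p)
    (b : ℤ) : GoodFor T (a • (lev p n (k + 1) w, v) + (lev p n k b, 0)) := by
  have e : a • (lev p n (k + 1) w, v) + (lev p n k b, 0) =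
      (lev p n (k + 1) (a * w + p * b), a • v) := by
    rw [lev_add, lev_succ_mul hk, Prod.smul_mk, zsmul_lev]
    simp
  have hco : IsCoprime (a * w + p * b) (p : ℤ) := by
    simpa [mul_comm] using (ha.mul_left hw).add_mul_left_left b
  rw [e]
  refine ⟨fun h0 => lev_ne_zero (by omega) hk hco (Prod.ext_iff.1 h0).1, fun h0 => hne ?_⟩
  obtain ⟨w', hw', hww'⟩ := exists_inv_mod hw n
  obtain ⟨a', ha', haa'⟩ := exists_inv_mod ha (n + 1)
  -- Multiplication by this unit carries (w, v) to (a w + p b, a v); its inverse m undoes this in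
  -- both coordinates.
  have hcm : IsCoprime (a + p * (b * w')) (p : ℤ) := by
    simpa [mul_comm] using ha.add_mul_left_left (b * w')
  obtain ⟨m, hm, hmm⟩ := exists_inv_mod hcm (n + 1)
  have hcast : ∀ {x y : ℤ} {i : ℕ}, i ≤ n + 1 → ((x : ℤ) : ZMod (p ^ (n + 1))) = y →
      ((x : ℤ) : ZMod (p ^ i)) = y := fun {x y i} hi hxy => by
    rw [ZMod.intCast_eq_intCast_iff_dvd_sub] at hxy ⊢
    exact (by exact_mod_cast pow_dvd_pow p hi : ((p ^ i : ℕ) : ℤ) ∣ _).trans hxy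
  have h1 := charSum_pairChar_zsmul hm h0
  have e1 : lev p n (k + 1) (m * (a * w + p * b)) = lev p n (k + 1) w := by
    apply lev_congr
    have h2 : ((m * (a + p * (b * w')) : ℤ) : ZMod (p ^ n)) = ((1 : ℤ) : ZMod (p ^ n)) :=
      hcast (Nat.le_succ n) (by rw [hmm, Int.cast_one])
    push_cast at h2 hww' ⊢
    linear_combination (w : ZMod (p ^ n)) * h2 - m * p * b * hww'
  have e2 : m • a • v = v := by
    have h2 : ((m * (a + p * (b * w')) : ℤ) : ZMod (p ^ 1)) = ((1 : ℤ) : ZMod (p ^ 1)) :=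
      hcast (by omega) (by rw [hmm, Int.cast_one])
    rw [pow_one] at h2
    push_cast at h2
    rw [CharP.cast_eq_zero, zero_mul, add_zero] at h2
    rw [zsmul_eq_mul, zsmul_eq_mul, ← mul_assoc, h2, one_mul]
  rwa [Prod.smul_mk, zsmul_lev, e1, e2] at h1

/-- The case in which the zeros of `T` on the first coordinate axis account for all of `|T|`. -/
lemma exists_goodFor_of_full {K : Finset ℕ} (hJK : ∀ k, 1 ≤ k → k ≤ n → (k ∈ J ↔ k ∉ K))
    (hJ1 : ∀ k ∈ J, 1 ≤ k) (hJn : ∀ k ∈ J, k ≤ n) (hK1 : ∀ k ∈ K, 1 ≤ k) (hKn : ∀ k ∈ K, k ≤ n)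
    (hJ : ∀ k ∈ J, charSum T (pairChar p n (lev p n k 1, 0)) = 0)
    (hK : ∀ k ∈ K, charSum T (pairChar p n (lev p n k 1, 0)) ≠ 0) (hT : T.card = p ^ J.card) :
    ∃ Λ : Finset (ZMod (p ^ n) × ZMod p), Λ.card = p ^ (K.card + 1) ∧
      ∀ x ∈ Λ, ∀ y ∈ Λ, x ≠ y → GoodFor T (x - y) := by
  classical
  have hp : p.Prime := Fact.out
  have hJ' : ∀ k ∈ J, k ≤ n → charSum T (pairChar p n (lev p n k 1, 0)) = 0 := fun k hk _ => hJ k hk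
  have hTne : T.Nonempty := card_pos.1 (by rw [hT]; exact pow_pos hp.pos _)
  have hsc : ∀ j, j + 1 ≤ n → j + 1 ∈ K → ∀ t ∈ T, ∀ t' ∈ T,
      (p : ZMod (p ^ n)) ^ j ∣ t.1 - t'.1 → (p : ZMod (p ^ n)) ^ (j + 1) ∣ t.1 - t'.1 :=
    fun j hj hjK t ht t' ht' h => pow_dvd_sub_of_notMem hJ' hJ1 hJn hT hj
      (fun hjJ => (hJK _ (by omega) hj).1 hjJ hjK) ht ht' h
  have hEn : ¬ VanishesUpTo T n := by
    refine not_vanishesUpTo_self hTne fun z => ?_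
    have h1 := card_fib_le hJ' hJ1 hT le_rfl z
    have h2 : J.filter (n < ·) = ∅ := by
      rw [filter_eq_empty_iff]
      intro k hk
      have := hJn k hk
      omega
    simpa [h2] using h1
  -- The least level k₀ where vanishing fails supplies the extra digit. Above it, digits from `K`
  -- are good for every second coordinate, since a zero there would propagate back down to k₀.
  have hE : ∃ j, ¬ VanishesUpTo T j := ⟨n, hEn⟩
  have hk₀n : Nat.find hE ≤ n := Nat.find_min' hE hEn
  obtain ⟨k₀, hk₀⟩ : ∃ k₀, k₀ = Nat.find hE := ⟨_, rfl⟩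
  have hspec : ¬ VanishesUpTo T k₀ := by rw [hk₀]; exact Nat.find_spec hE
  have hmin : ∀ j < k₀, VanishesUpTo T j := fun j hj => by
    rw [hk₀] at hj
    exact not_not.1 (Nat.find_min hE hj)
  rw [← hk₀] at hk₀n
  have hKtop : ∀ k ∈ K, k₀ < k → k ≤ n → ∀ w : ℤ, IsCoprime w p → ∀ v ∈ (⊤ : AddSubgroup (ZMod p)),
      charSum T (pairChar p n (lev p n k w, v)) ≠ 0 := by
    intro k hk hkk hkn w hw v _ h0
    by_cases hv : v = 0
    · rw [hv] at h0
      exact hK k hk (charSum_lev_eq_zero hw h0)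
    · obtain ⟨j, rfl⟩ : ∃ j, k = j + 1 := ⟨k - 1, by omega⟩
      exact hspec ((vanishesUpTo_succ_of_charSum_eq_zero hkn (hsc j hkn hk) hw hv h0).mono hkk.le hkn)
  rcases Nat.eq_zero_or_pos k₀ with h00 | h0pos
  · subst h00
    have hv : ∀ v : ZMod p, v ≠ 0 → charSum T (pairChar p n (0, v)) ≠ 0 := by
      intro v hv h0
      apply hspec
      intro w v' hv'
      rw [lev_zero]
      exact charSum_pairChar_zero_eq_zero hv hv' h0
    obtain ⟨Λ, hc, -, hg⟩ := exists_extend_digits (T := T) K ⊤ (k₀ := 0)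
      (Λ₀ := univ.image fun v : ZMod p => ((0 : ZMod (p ^ n)), v))
      (by
        intro x hx
        obtain ⟨v, -, rfl⟩ := mem_image.1 hx
        exact ⟨⟨0, by rw [lev_zero]⟩, trivial⟩)
      (by
        intro x hx y hy hne
        obtain ⟨v, -, rfl⟩ := mem_image.1 hx
        obtain ⟨v', -, rfl⟩ := mem_image.1 hy
        have hvv : v - v' ≠ 0 := fun e => hne (by rw [sub_eq_zero.1 e])
        rw [Prod.mk_sub_mk, sub_zero]
        exact ⟨fun e => hvv (Prod.ext_iff.1 e).2, hv _ hvv⟩)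
      hKtop (Nat.zero_le n) le_rfl
    refine ⟨Λ, ?_, hg⟩
    rw [hc, card_image_of_injective _ fun _ _ e => (Prod.ext_iff.1 e).2, card_univ, ZMod.card,
      pow_succ, filter_true_of_mem fun k hk => ⟨hK1 k hk, hKn k hk⟩]
  · obtain ⟨j, rfl⟩ : ∃ j, k₀ = j + 1 := ⟨k₀ - 1, by omega⟩
    -- At a level of `K` the vanishing below would propagate upwards, so k₀ is not in `K` and its
    -- digit is a genuinely new factor p.
    have hjK : j + 1 ∉ K := fun hmem => hspec
      (vanishesUpTo_succ_of_sum_fib hk₀n (hsc j hk₀n hmem) fun z v hv =>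
        (hmin j (Nat.lt_succ_self j)).sum_fib (by omega) z hv)
    obtain ⟨w, v, hw, hne⟩ := exists_generator hspec (hmin j (Nat.lt_succ_self j)) hk₀n
    obtain ⟨Λ₁, hc₁, hm₁, hg₁⟩ := exists_extend_digits (T := T) K ⊥ (k₀ := 0) (j := j) (Λ₀ := {0})
      (fun x hx => by
        rw [mem_singleton] at hx
        subst hx
        exact ⟨⟨0, by rw [lev_zero]; rfl⟩, rfl⟩)
      (fun x hx y hy hxy => (hxy ((mem_singleton.1 hx).trans (mem_singleton.1 hy).symm)).elim)
      (fun k hk _ _ w hw v hv h0 => hK k hk (charSum_lev_eq_zero hw (by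
        rw [AddSubgroup.mem_bot] at hv
        rwa [hv] at h0))) (Nat.zero_le j) (by omega)
    obtain ⟨Λ₂, hc₂, hg₂, hm₂⟩ := exists_extend_good (p := p) (Good := GoodFor T)
      (fun h => h.1 rfl) hg₁ (g := (lev p n (j + 1) w, v)) (by
        intro a ha x hx y hy
        obtain ⟨⟨b, hb⟩, hxV⟩ := hm₁ x hx
        obtain ⟨⟨b', hb'⟩, hyV⟩ := hm₁ y hy
        rw [AddSubgroup.mem_bot] at hxV hyV
        have : x - y = (lev p n j (b - b'), 0) := by
          rw [lev_sub, ← hb, ← hb']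
          exact Prod.ext rfl (by rw [Prod.snd_sub, hxV, hyV, sub_zero])
        rw [this]
        exact goodFor_generator hk₀n hw hne ha _)
    obtain ⟨Λ, hc, -, hg⟩ := exists_extend_digits (T := T) K ⊤ (k₀ := j + 1) (Λ₀ := Λ₂)
      (by
        intro x' hx'
        obtain ⟨a, x, hx, rfl⟩ := hm₂ x' hx'
        obtain ⟨⟨b, hb⟩, -⟩ := hm₁ x hx
        refine ⟨⟨a * w + p * b, ?_⟩, trivial⟩
        rw [lev_add, lev_succ_mul hk₀n, ← hb, Prod.smul_mk, zsmul_lev]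
        rfl)
      hg₂ hKtop hk₀n le_rfl
    refine ⟨Λ, ?_, hg⟩
    have hsplit : K.card = (K.filter fun k => j + 1 < k ∧ k ≤ n).card +
        (K.filter fun k => 0 < k ∧ k ≤ j).card := by
      rw [← card_union_of_disjoint]
      · congr 1
        ext k
        simp only [mem_union, mem_filter]
        constructor
        · intro hk
          have h1 := hK1 k hk
          have h2 := hKn k hk
          have h3 : k ≠ j + 1 := fun e => hjK (e ▸ hk)
          by_cases h4 : k ≤ j
          · exact Or.inr ⟨hk, h1, h4⟩
          · exact Or.inl ⟨hk, by omega, h2⟩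
        · rintro (h | h)
          · exact h.1
          · exact h.1
      · rw [disjoint_left]
        intro k h1 h2
        have h1 := (mem_filter.1 h1).2
        have h2 := (mem_filter.1 h2).2
        omega
    rw [hc, hc₂, hc₁, card_singleton, hsplit, pow_succ, pow_add]
    ring

lemma hasUniversalSpectra_cyclic_prod_prime (p n : ℕ) [Fact p.Prime] :
    HasUniversalSpectra (ZMod (p ^ n) × ZMod p) := by
  classical
  have hp : p.Prime := Fact.out
  refine hasUniversalSpectra_of_forall fun B T h => ?_
  suffices hs : ∃ Λ : Finset (ZMod (p ^ n) × ZMod p), Λ.card = B.card ∧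
      ∀ x ∈ Λ, ∀ y ∈ Λ, x ≠ y → GoodFor T (x - y) by
    obtain ⟨Λ, hc, hg⟩ := hs
    refine ⟨Λ.image (pairChar p n), by rw [card_image_of_injective _ pairChar_injective, hc], ?_⟩
    intro χ hχ ψ hψ hne
    obtain ⟨x, hx, rfl⟩ := mem_image.1 hχ
    obtain ⟨y, hy, rfl⟩ := mem_image.1 hψ
    rw [← map_sub]
    exact (hg x hx y hy fun e => hne (by rw [e])).2
  let J := (Icc 1 n).filter fun k => charSum T (pairChar p n (lev p n k 1, 0)) = 0
  let K := (Icc 1 n).filter fun k => ¬ charSum T (pairChar p n (lev p n k 1, 0)) = 0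
  have hJ1 : ∀ k ∈ J, 1 ≤ k := fun k hk => (mem_Icc.1 (mem_filter.1 hk).1).1
  have hJn : ∀ k ∈ J, k ≤ n := fun k hk => (mem_Icc.1 (mem_filter.1 hk).1).2
  have hK1 : ∀ k ∈ K, 1 ≤ k := fun k hk => (mem_Icc.1 (mem_filter.1 hk).1).1
  have hKn : ∀ k ∈ K, k ≤ n := fun k hk => (mem_Icc.1 (mem_filter.1 hk).1).2
  have hJ : ∀ k ∈ J, charSum T (pairChar p n (lev p n k 1, 0)) = 0 := fun k hk => (mem_filter.1 hk).2
  have hK : ∀ k ∈ K, charSum T (pairChar p n (lev p n k 1, 0)) ≠ 0 := fun k hk => (mem_filter.1 hk).2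
  have hJK : J.card + K.card = n := by
    rw [card_filter_add_card_filter_not, Nat.card_Icc, Nat.add_sub_cancel]
  have hco1 : IsCoprime (1 : ℤ) p := isCoprime_one_left
  have hKB : ∀ k ∈ K, charSum B (pairChar p n (lev p n k 1, 0)) = 0 := by
    intro k hk
    refine (mul_eq_zero.1 (h.charSum_mul fun e => ?_)).resolve_right (hK k hk)
    have := pairChar_injective (e.trans (map_zero (pairChar p n)).symm)
    exact lev_ne_zero (hK1 k hk) (hKn k hk) hco1 (Prod.ext_iff.1 this).1
  have hc : B.card * T.card = p ^ (n + 1) := by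
    rw [h.card_mul]; simp [pow_succ]
  obtain ⟨s, -, hs⟩ := (Nat.dvd_prime_pow hp).1 (⟨B.card, by rw [mul_comm, hc]⟩ : T.card ∣ p ^ (n + 1))
  obtain ⟨r, -, hr⟩ := (Nat.dvd_prime_pow hp).1 (⟨T.card, hc.symm⟩ : B.card ∣ p ^ (n + 1))
  have hrs : r + s = n + 1 := by
    rw [hs, hr, ← pow_add] at hc
    exact Nat.pow_right_injective hp.two_le hc
  have hJs : J.card ≤ s := by
    have := pow_card_dvd_card hJ1 hJn hJ
    rw [hs] at this
    exact (Nat.pow_dvd_pow_iff_le_right hp.one_lt).1 this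
  have hKr : K.card ≤ r := by
    have := pow_card_dvd_card hK1 hKn hKB
    rw [hr] at this
    exact (Nat.pow_dvd_pow_iff_le_right hp.one_lt).1 this
  -- From |J| + |K| = n, r + s = n + 1, |J| ≤ s and |K| ≤ r, exactly one inequality is strict, and
  -- by one. If |K| = r, digits on the first axis are enough; otherwise |T| = p ^ |J|.
  by_cases hKr' : K.card = r
  · obtain ⟨Λ, hc, -, hg⟩ := exists_extend_digits (T := T) K ⊥ (k₀ := 0) (j := n) (Λ₀ := {0})
      (fun x hx => by
        rw [mem_singleton] at hx
        subst hx
        exact ⟨⟨0, by rw [lev_zero]; rfl⟩, rfl⟩)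
      (fun x hx y hy hxy => (hxy ((mem_singleton.1 hx).trans (mem_singleton.1 hy).symm)).elim)
      (fun k hk _ _ w hw v hv h0 => hK k hk (charSum_lev_eq_zero hw (by
        rw [AddSubgroup.mem_bot] at hv
        rwa [hv] at h0))) (Nat.zero_le n) le_rfl
    refine ⟨Λ, ?_, hg⟩
    rw [hc, filter_true_of_mem fun k hk => ⟨hK1 k hk, hKn k hk⟩, hKr', card_singleton, mul_one, hr]
  · have hJs' : J.card = s := by omega
    obtain ⟨Λ, hc, hg⟩ := exists_goodFor_of_full (J := J) (K := K)
      (fun k h1 h2 => by simp [J, K, h1, h2]) hJ1 hJn hK1 hKn hJ hK (by rw [hs, hJs'])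
    exact ⟨Λ, by rw [hc, hr]; congr 1; omega, hg⟩

end CyclicTimesPrimeMain

theorem mainTheorem6 {G : Type*} [AddCommGroup G] [Finite G]
    (hG : IsSubgroupOf G (Fin 5 → ZMod 2) ∨
      (∃ p : ℕ, p.Prime ∧ IsSubgroupOf G (Fin 3 → ZMod p)) ∨
      (∃ p n : ℕ, p.Prime ∧ 0 < n ∧ IsSubgroupOf G (ZMod (p ^ n) × ZMod p)) ∨
      IsSubgroupOf G (ZMod (2 ^ 3) × (Fin 2 → ZMod 2)) ∨
      IsSubgroupOf G (ZMod (2 ^ 2) × (Fin 3 → ZMod 2)))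
    (m : ℕ) [NeZero m] (hm : Squarefree m) (hcop : Nat.gcd (Nat.card G) m = 1)
    (Ω : Finset (G × ZMod m)) (hΩ : IsTile Ω) :
    IsSpectralSet Ω := by
  have hU : HasUniversalSpectra G := by
    rcases hG with ⟨f, hf⟩ | ⟨p, hp, f, hf⟩ | ⟨p, n, hp, -, f, hf⟩ | ⟨f, hf⟩ | ⟨f, hf⟩
    · exact hasUniversalSpectra_two_pow_five.of_injective f hf
    · have : Fact p.Prime := ⟨hp⟩
      exact hasUniversalSpectra_prime_pow_three.of_injective f hf
    · have : Fact p.Prime := ⟨hp⟩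
      exact (hasUniversalSpectra_cyclic_prod_prime p n).of_injective f hf
    · exact hasUniversalSpectra_eight_two_pow_two.of_injective f hf
    · exact hasUniversalSpectra_four_two_pow_three.of_injective f hf
  exact (hU.prod_zmod_of_squarefree m inferInstance hm hcop).isSpectralSet hΩ
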